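/- Let $\eta$ be a homogeneous Poisson point process on $\mathbb R^2\times[0,1]$ of intensity $\lambda\ge 0$, with law $\mathbb P_\lambda$, and let $\varphi:\mathbb R^2\to[0,\infty)$ be a (jointly measurable) stationary and ergodic random field, with law $\overline{\mathbb P}$, independent of $\eta$; write $\mathbf P_\lambda=\mathbb P_\lambda\times\overline{\mathbb P}$. Let $B(x,r)$ be the closed Euclidean disc and $B_\infty(x,r)$ the closed $\ell_\infty$-ball (square) with centre $x$ and radius $r$, let $$\mathcal O=\bigcup_{(x,z)\in\eta}B(x,\varphi(x)),\qquad \mathcal O_K=\bigcup_{(x,z)\in\eta,\ x\in K}B(x,\varphi(x))\quad(K\subset\mathbb R^2).$$ Fix $\varepsilon_0\in(0,1/5]$. For integers $n\ge1$, put $K_n=B_\infty(0,n)$, $K_n'=B_\infty(0,(1+\varepsilon_0/4)n)$, $$\pi_\lambda(n)=\mathbf P_\lambda\big(\mathcal O\cap K_n\ne\mathcal O_{K_n'}\cap K_n\big),\qquad \overline\pi(n)=\sup_{g_1,g_2}\big|\overline{\mathbb E}[g_1g_2]-\overline{\mathbb E}[g_1]\,\overline{\mathbb E}[g_2]\big|,$$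 where the supremum is over all $[0,1]$-valued $g_1,g_2$ such that $g_1$ is measurable with respect to $\sigma(\varphi(x):x\in K_n')$ and $g_2$ with respect to $\sigma(\varphi(x):x\in((2+\varepsilon_0)n,0)+K_n')$. For $s,t>0$ let $\mathrm{Cross}(s,t)$ be the event that $\mathcal O\cap([0,s]\times[0,t])$ contains a continuous curve connecting $\{0\}\times[0,t]$ to $\{s\}\times[0,t]$, and let $\{0\stackrel{\mathcal O}{\leftrightarrow}\infty\}$ be the event that $\mathcal O$ contains a continuous curve connecting the origin to points arbitrarily far away. **Proposition.** Assume that the law of $\varphi$ is invariant under rotations by right angles, that $\pi_\lambda(n)\to0$ as $n\to\infty$, and that for some $\alpha>0$ we have $\overline\pi(n)\le(\alpha\log n)^{-(1+\alpha)}$ for all integers $n\ge2$. Then $$\lim_{n\to\infty}\mathbf P_\lambda\big(\mathrm{Cross}(3n,n)\big)=1\quad\Longrightarrow\quad \mathbf P_\lambda\big(0\stackrel{\mathcal O}{\leftrightarrow}\infty\big)>0 .$$ -/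

import Mathlib

open MeasureTheory ProbabilityTheory Filter Topology
open scoped NNReal ENNReal

noncomputable section

namespace Gilbert

/-- The Euclidean plane. -/
abbrev Plane : Type := EuclideanSpace ℝ (Fin 2)

/-- The closed square (closed ball of the supremum norm) with centre `x` and radius `r`. -/
def square (x : Plane) (r : ℝ) : Set Plane := {y | ∀ i, |y i - x i| ≤ r}

/-- The rectangle `[0, s] × [0, t]`. -/
def rect (s t : ℝ) : Set Plane := {y | 0 ≤ y 0 ∧ y 0 ≤ s ∧ 0 ≤ y 1 ∧ y 1 ≤ t}

/-- Counterclockwise rotation of the plane by a right angle about the origin. -/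
def rot (x : Plane) : Plane := !₂[-x 1, x 0]

/-- `η` is a homogeneous Poisson point process on `ℝ² × [0,1]` with intensity `lam`, the random
counting measure being identified with its support. The number of points in a Borel set `A` is
`(η ω ∩ A).encard`. -/
structure IsPoissonProcess {Ω : Type*} [MeasurableSpace Ω] (μ : Measure Ω) (lam : ℝ≥0)
    (η : Ω → Set (Plane × unitInterval)) : Prop where
  /-- Configurations are locally finite. -/
  finite_inter : ∀ ω, ∀ K : Set (Plane × unitInterval), IsCompact K → (η ω ∩ K).Finite
  /-- The number of points in a Borel set is a random variable. -/
  measurable_count : ∀ A : Set (Plane × unitInterval), MeasurableSet A →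
    Measurable fun ω => (η ω ∩ A).encard
  /-- The number of points in a Borel set of finite volume is Poisson distributed, with mean
  `lam` times the volume. -/
  count_law : ∀ A : Set (Plane × unitInterval), MeasurableSet A → volume A ≠ ∞ → ∀ k : ℕ,
    μ {ω | (η ω ∩ A).encard = k} = poissonMeasure (lam * (volume A).toNNReal) {k}
  /-- The numbers of points in pairwise disjoint Borel sets are independent. -/
  count_indep : ∀ (m : ℕ) (A : Fin m → Set (Plane × unitInterval)), (∀ i, MeasurableSet (A i)) →
    Pairwise (fun i j => Disjoint (A i) (A j)) → iIndepFun (fun i ω => (η ω ∩ A i).encard) μ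

section Field

variable {Ω' : Type*} [MeasurableSpace Ω']

/-- The law of the random field is invariant under all translations. -/
def IsStationary (ν : Measure Ω') (φ : Ω' → Plane → ℝ≥0) : Prop :=
  ∀ (v : Plane) (k : ℕ) (y : Fin k → Plane),
    IdentDistrib (fun ω i => φ ω (y i + v)) (fun ω i => φ ω (y i)) ν ν

/-- Every translation invariant event of the field has probability zero or one. The function space
carries the sigma algebra generated by the evaluation maps. -/
def IsErgodicField (ν : Measure Ω') (φ : Ω' → Plane → ℝ≥0) : Prop :=
  ∀ A : Set (Plane → ℝ≥0), MeasurableSet A →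
    (∀ v : Plane, (fun (f : Plane → ℝ≥0) (x : Plane) => f (x - v)) ⁻¹' A = A) →
    ν {ω | φ ω ∈ A} = 0 ∨ ν {ω | φ ω ∈ A} = 1

/-- The law of the random field is invariant under rotations by right angles. -/
def IsRotationInvariant (ν : Measure Ω') (φ : Ω' → Plane → ℝ≥0) : Prop :=
  ∀ (k : ℕ) (y : Fin k → Plane),
    IdentDistrib (fun ω i => φ ω (rot (y i))) (fun ω i => φ ω (y i)) ν ν

/-- The sigma algebra `σ(φ(x) : x ∈ S)`. -/
abbrev fieldSigma (φ : Ω' → Plane → ℝ≥0) (S : Set Plane) : MeasurableSpace Ω' :=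
  ⨆ x ∈ S, MeasurableSpace.comap (fun ω => φ ω x) inferInstance

/-- The correlation coefficient `π̄(n)` of the field: the supremum of `|E[g₁g₂] - E[g₁]E[g₂]|` over
`[0,1]`-valued functions `g₁`, `g₂` of the restrictions of the field to two separated squares.
(The values in this supremum lie in `[0,1]`, so that it is a genuine supremum.) -/
def piBar (ν : Measure Ω') (φ : Ω' → Plane → ℝ≥0) (ε₀ : ℝ) (n : ℕ) : ℝ :=
  sSup {c : ℝ | ∃ g₁ g₂ : Ω' → ℝ,
    (∀ ω, g₁ ω ∈ Set.Icc (0 : ℝ) 1) ∧ (∀ ω, g₂ ω ∈ Set.Icc (0 : ℝ) 1) ∧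
    Measurable[fieldSigma φ (square 0 ((1 + ε₀ / 4) * n))] g₁ ∧
    Measurable[fieldSigma φ (square !₂[(2 + ε₀) * n, 0] ((1 + ε₀ / 4) * n))] g₂ ∧
    c = |(∫ ω, g₁ ω * g₂ ω ∂ν) - (∫ ω, g₁ ω ∂ν) * (∫ ω, g₂ ω ∂ν)|}

end Field

/-- The occupied set: the union of the closed discs `B(x, f x)` over the points `(x, z)` of the
configuration `s`. -/
def occupied (s : Set (Plane × unitInterval)) (f : Plane → ℝ≥0) : Set Plane :=
  ⋃ p ∈ s, Metric.closedBall p.1 (f p.1)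

/-- The set occupied by the discs that are centred in `K`. -/
def occupiedFrom (K : Set Plane) (s : Set (Plane × unitInterval)) (f : Plane → ℝ≥0) : Set Plane :=
  occupied (s ∩ {p | p.1 ∈ K}) f

/-- `O ∩ ([0,s] × [0,t])` contains a continuous curve from the left side to the right side of the
rectangle `[0,s] × [0,t]`. -/
def HasCrossing (O : Set Plane) (s t : ℝ) : Prop :=
  ∃ x y : Plane, x 0 = 0 ∧ y 0 = s ∧ JoinedIn (O ∩ rect s t) x y

/-- `O` contains a continuous curve from the origin to points arbitrarily far away. -/
def OriginToInfinity (O : Set Plane) : Prop :=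
  ∃ γ : ℝ≥0 → Plane, Continuous γ ∧ γ 0 = 0 ∧ (∀ t, γ t ∈ O) ∧ ∀ R : ℝ, ∃ t, R < ‖γ t‖

/-- The quantity `π_λ(n)`: the probability, under the product measure, that some disc centred
outside the square of radius `(1 + ε₀/4) n` affects the occupied set inside the square of
radius `n`. -/
def piLam {Ω Ω' : Type*} [MeasurableSpace Ω] [MeasurableSpace Ω'] (μ : Measure Ω) (ν : Measure Ω')
    (η : Ω → Set (Plane × unitInterval)) (φ : Ω' → Plane → ℝ≥0) (ε₀ : ℝ) (n : ℕ) : ℝ≥0∞ :=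
  (μ.prod ν) {w | occupied (η w.1) (φ w.2) ∩ square 0 n ≠
    occupiedFrom (square 0 ((1 + ε₀ / 4) * n)) (η w.1) (φ w.2) ∩ square 0 n}

end Gilbert

end

/-!
The proof is a renormalization argument for crossings of rectangles. Let `g n` be the probability
that the rectangle `[0, 3n] × [0, n]` is *not* crossed by the discs centred in a square of radius
comparable to `n` around it (`hCross`). Restricting the centres costs at most `piLam (4n)`, so
that `g n → 0` (`tendsto_measureReal_hCross_compl`); conversely such a local crossing is a crossing
by the full occupied set, so that `piLam` plays no further role.

A rectangle at scale `27n` is crossed as soon as a strip of overlapping crossed rectangles at scale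
`n`, horizontal and vertical, runs along its bottom or along its top. If it is not crossed, then
both strips contain an uncrossed rectangle. Two such rectangles depend on discs centred in two
squares in the position of the definition of `piBar (50n)`, which yields the bootstrap inequality
`g (27n) ≤ C (g n ² + piBar (50n))` (`measureReal_hCross_compl_le`). The decay of `piBar` makes
`piBar (50 · 3 ^ k)` summable in `k`, hence also `g (3 ^ k)` (`summable_measureReal_hCross_compl`).
With positive probability, therefore, all the rectangles `[0, 3 · 3 ^ k] × [0, 3 ^ k]` and their
rotated copies are crossed for large `k`. Consecutive crossings meet, and their union is an unbounded
connected set. It is connected to some point of a countable dense set, and by stationarity the origin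
is as good as any other point.

Two points need care. That a horizontal and a vertical crossing meet
(`paths_meet`) is derived from a planar Poincaré–Miranda theorem, proved with a continuous
logarithm. Since the hypotheses and the conclusion speak of outer measures of events whose
measurability is not obvious, the argument is run with connections through discs centred in bounded
sets (`LinkData`): these are finite chains of intersecting discs, whence measurable events
(`measurableSet_linked`). They depend on the Poisson process through a random finite configuration
(`FinConf`), whose law is invariant under isometries (`IsPoissonProcess.map_window_eq`) and whose
restrictions to disjoint sets are independent (`IsPoissonProcess.indepFun_window`).
-/

namespace Gilbert

/-! ### Crossing curves in a rectangle meet -/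

/-- A continuous angle whose sine stays nonnegative cannot leave the interval `[0, π]`. -/
lemma mem_Icc_pi_of_sin_nonneg {θ : ℝ → ℝ} (hθ : Continuous θ) {a b : ℝ}
    (hsin : ∀ t ∈ Set.uIcc a b, 0 ≤ Real.sin (θ t)) (ha : θ a ∈ Set.Icc 0 Real.pi) :
    θ b ∈ Set.Icc 0 Real.pi := by
  have hpi := Real.pi_pos
  have ivt : Set.uIcc (θ a) (θ b) ⊆ θ '' Set.uIcc a b :=
    intermediate_value_uIcc hθ.continuousOn
  by_contra hb
  rw [Set.mem_Icc, not_and_or, not_le, not_le] at hb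
  rcases hb with hb | hb
  · obtain ⟨t, ht, hv⟩ := ivt (show max (θ b) (-(Real.pi / 2)) ∈ _ from by
      rw [Set.mem_uIcc]; right
      exact ⟨le_max_left _ _, max_le (by linarith [ha.1]) (by linarith [ha.1])⟩)
    have h1 := hsin t ht
    have h2 : Real.sin (θ t) < 0 := by
      rw [hv]
      exact Real.sin_neg_of_neg_of_neg_pi_lt (max_lt hb (by linarith))
        (lt_max_of_lt_right (by linarith))
    linarith
  · obtain ⟨t, ht, hv⟩ := ivt (show min (θ b) (3 * Real.pi / 2) ∈ _ from by
      rw [Set.mem_uIcc]; left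
      exact ⟨le_min (by linarith [ha.2]) (by linarith [ha.2]), min_le_left _ _⟩)
    have h1 := hsin t ht
    have h2 : Real.sin (θ t - 2 * Real.pi) < 0 := by
      rw [hv]
      refine Real.sin_neg_of_neg_of_neg_pi_lt ?_ ?_
      · linarith [min_le_right (θ b) (3 * Real.pi / 2)]
      · have : Real.pi < min (θ b) (3 * Real.pi / 2) := lt_min hb (by linarith)
        linarith
    rw [Real.sin_sub_two_pi] at h2
    linarith

/-- A planar Poincaré–Miranda theorem: a continuous map of the square `[0, 1]²` to `ℂ`, whose real
part changes sign between the left and right sides and whose imaginary part changes sign between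
the bottom and top sides, has a zero. Otherwise a continuous branch of its argument would change
by `-2π` along the boundary of the square. -/
lemma exists_zero_of_sides {f : ℝ × ℝ → ℂ} (hf : Continuous f)
    (hl : ∀ t ∈ Set.Icc (0 : ℝ) 1, (f (0, t)).re ≤ 0)
    (hr : ∀ t ∈ Set.Icc (0 : ℝ) 1, 0 ≤ (f (1, t)).re)
    (hb : ∀ s ∈ Set.Icc (0 : ℝ) 1, 0 ≤ (f (s, 0)).im)
    (ht : ∀ s ∈ Set.Icc (0 : ℝ) 1, (f (s, 1)).im ≤ 0) :
    ∃ p, f p = 0 := by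
  by_contra! hne
  have hpi := Real.pi_pos
  obtain ⟨F, ⟨hF0, hF⟩, -⟩ := Complex.isCoveringMapOn_exp.existsUnique_continuousMap_lifts
    ⟨f, hf⟩ (a₀ := ((0 : ℝ), (0 : ℝ))) (Complex.exp_log (hne (0, 0))) (fun a => hne a)
  set θ : ℝ × ℝ → ℝ := fun p => (F p).im with hθdef
  have hθ : Continuous θ := Complex.continuous_im.comp F.continuous
  have hre : ∀ p, (f p).re = Real.exp (F p).re * Real.cos (θ p) := fun p => by
    rw [← Complex.exp_re]; exact congrArg Complex.re (congrFun hF p).symm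
  have him : ∀ p, (f p).im = Real.exp (F p).re * Real.sin (θ p) := fun p => by
    rw [← Complex.exp_im]; exact congrArg Complex.im (congrFun hF p).symm
  have hpos : ∀ p, 0 < Real.exp (F p).re := fun p => Real.exp_pos _
  have I0 : (0 : ℝ) ∈ Set.Icc (0 : ℝ) 1 := by simp
  have I1 : (1 : ℝ) ∈ Set.Icc (0 : ℝ) 1 := by simp
  replace hl : ∀ t ∈ Set.Icc (0 : ℝ) 1, Real.cos (θ (0, t)) ≤ 0 := fun t h => by
    have := hl t h; rw [hre] at this; exact nonpos_of_mul_nonpos_right this (hpos _)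
  replace hr : ∀ t ∈ Set.Icc (0 : ℝ) 1, 0 ≤ Real.cos (θ (1, t)) := fun t h => by
    have := hr t h; rw [hre] at this; exact nonneg_of_mul_nonneg_right this (hpos _)
  replace ht : ∀ s ∈ Set.Icc (0 : ℝ) 1, Real.sin (θ (s, 1)) ≤ 0 := fun t h => by
    have := ht t h; rw [him] at this; exact nonpos_of_mul_nonpos_right this (hpos _)
  have h00 : θ (0, 0) ∈ Set.Icc 0 Real.pi := by
    simp only [hθdef, hF0, Complex.log_im]
    exact ⟨Complex.arg_nonneg_iff.2 (hb 0 I0), Complex.arg_le_pi _⟩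
  replace hb : ∀ s ∈ Set.Icc (0 : ℝ) 1, 0 ≤ Real.sin (θ (s, 0)) := fun t h => by
    have := hb t h; rw [him] at this; exact nonneg_of_mul_nonneg_right this (hpos _)
  have e01 : Set.uIcc (0 : ℝ) 1 = Set.Icc 0 1 := Set.uIcc_of_le zero_le_one
  have e10 : Set.uIcc (1 : ℝ) 0 = Set.Icc 0 1 := Set.uIcc_of_ge zero_le_one
  have h10 : θ (1, 0) ∈ Set.Icc 0 Real.pi :=
    mem_Icc_pi_of_sin_nonneg (θ := fun s => θ (s, 0)) (by fun_prop) (a := 0) (b := 1)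
      (by rw [e01]; exact hb) h00
  have h10' : θ (1, 0) ≤ Real.pi / 2 := by
    by_contra! h
    linarith [hr 0 I0, Real.cos_neg_of_pi_div_two_lt_of_lt h (by linarith [h10.2])]
  have h11 : θ (1, 1) + Real.pi / 2 ∈ Set.Icc 0 Real.pi :=
    mem_Icc_pi_of_sin_nonneg (θ := fun t => θ (1, t) + Real.pi / 2) (by fun_prop) (a := 0) (b := 1)
      (by simpa only [e01, Real.sin_add_pi_div_two] using hr)
      ⟨by linarith [h10.1], by linarith⟩
  have h11' : θ (1, 1) ≤ 0 := by
    by_contra! h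
    linarith [ht 1 I1, Real.sin_pos_of_pos_of_lt_pi h (by linarith [h11.2])]
  have h01 : θ (0, 1) + Real.pi ∈ Set.Icc 0 Real.pi :=
    mem_Icc_pi_of_sin_nonneg (θ := fun s => θ (s, 1) + Real.pi) (by fun_prop) (a := 1) (b := 0)
      (by simpa only [e10, Real.sin_add_pi, Left.nonneg_neg_iff] using ht)
      ⟨by linarith [h11.1], by linarith⟩
  have h01' : θ (0, 1) ≤ -(Real.pi / 2) := by
    by_contra! h
    linarith [hl 1 I1, Real.cos_nonneg_of_neg_pi_div_two_le_of_le h.le (by linarith [h01.2]),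
      Real.cos_pos_of_mem_Ioo ⟨h, by linarith [h01.2]⟩]
  have hsh : ∀ x : ℝ, Real.sin (x + 3 * Real.pi / 2) = -Real.cos x := fun x => by
    rw [show x + 3 * Real.pi / 2 = x + Real.pi / 2 + Real.pi by ring, Real.sin_add_pi,
      Real.sin_add_pi_div_two]
  have h00' : θ (0, 0) + 3 * Real.pi / 2 ∈ Set.Icc 0 Real.pi :=
    mem_Icc_pi_of_sin_nonneg (θ := fun t => θ (0, t) + 3 * Real.pi / 2) (by fun_prop)
      (a := 1) (b := 0) (by simpa only [e10, hsh, Left.nonneg_neg_iff] using hl)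
      ⟨by linarith [h01.1], by linarith⟩
  linarith [h00'.2, h00.1]

/-- A curve that stays between two horizontal lines and traverses a rectangle from left to right
meets every curve that stays between two vertical lines and traverses it from bottom to top. -/
lemma paths_meet {x₁ x₂ y₁ y₂ : Plane} (α : Path x₁ x₂) (β : Path y₁ y₂) {a b c d : ℝ}
    (hα₁ : x₁ 0 ≤ a) (hα₂ : b ≤ x₂ 0) (hα : ∀ s, c ≤ α s 1 ∧ α s 1 ≤ d)
    (hβ₁ : y₁ 1 ≤ c) (hβ₂ : d ≤ y₂ 1) (hβ : ∀ t, a ≤ β t 0 ∧ β t 0 ≤ b) :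
    ∃ s t, α s = β t := by
  let A : ℝ → Plane := α.extend
  let B : ℝ → Plane := β.extend
  have hA : Continuous A := α.continuous_extend
  have hB : Continuous B := β.continuous_extend
  have hAr : ∀ s, ∃ s', A s = α s' := fun s => ⟨_, rfl⟩
  have hBr : ∀ s, ∃ s', B s = β s' := fun s => ⟨_, rfl⟩
  let f : ℝ × ℝ → ℂ := fun p => ⟨A p.1 0 - B p.2 0, A p.1 1 - B p.2 1⟩
  have hf : Continuous f := by
    have : f = fun p => ((A p.1 0 - B p.2 0 : ℝ) : ℂ) + ((A p.1 1 - B p.2 1 : ℝ) : ℂ) * Complex.I :=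
      funext fun p => Complex.mk_eq_add_mul_I _ _
    rw [this]
    fun_prop
  have hA0 : A 0 = x₁ := α.extend_zero
  have hA1 : A 1 = x₂ := α.extend_one
  have hB0 : B 0 = y₁ := β.extend_zero
  have hB1 : B 1 = y₂ := β.extend_one
  obtain ⟨p, hp⟩ := exists_zero_of_sides hf
    (fun t _ => by
      obtain ⟨t', e⟩ := hBr t
      simp only [f, hA0, e]; linarith [(hβ t').1])
    (fun t _ => by
      obtain ⟨t', e⟩ := hBr t
      simp only [f, hA1, e]; linarith [(hβ t').2])
    (fun t _ => by
      obtain ⟨t', e⟩ := hAr t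
      simp only [f, hB0, e]; linarith [(hα t').1])
    (fun t _ => by
      obtain ⟨t', e⟩ := hAr t
      simp only [f, hB1, e]; linarith [(hα t').2])
  obtain ⟨s, hs⟩ := hAr p.1
  obtain ⟨t, ht⟩ := hBr p.2
  refine ⟨s, t, ?_⟩
  rw [← hs, ← ht]
  have h0 := congrArg Complex.re hp
  have h1 := congrArg Complex.im hp
  simp only [f, Complex.zero_re, Complex.zero_im] at h0 h1
  ext i
  fin_cases i
  · simpa using sub_eq_zero.1 h0
  · simpa using sub_eq_zero.1 h1

/-- The rectangle `[a, b] × [c, d]`. -/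
def box (a b c d : ℝ) : Set Plane := {u | (a ≤ u 0 ∧ u 0 ≤ b) ∧ c ≤ u 1 ∧ u 1 ≤ d}

/-- The points whose `i`-th coordinate is `a`. -/
def axisLine (i : Fin 2) (a : ℝ) : Set Plane := {u | u i = a}

/-- A horizontal and a vertical crossing inside `S`, of rectangles that overlap like the bars of
a cross, belong to the same path component of `S`. -/
lemma joinedIn_of_cross {S W₁ W₂ : Set Plane} {x₁ x₂ y₁ y₂ : Plane}
    (h₁ : JoinedIn W₁ x₁ x₂) (h₂ : JoinedIn W₂ y₁ y₂) (hS₁ : W₁ ⊆ S) (hS₂ : W₂ ⊆ S)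
    {a b c d : ℝ} (hx₁ : x₁ 0 ≤ a) (hx₂ : b ≤ x₂ 0) (hW₁ : ∀ u ∈ W₁, c ≤ u 1 ∧ u 1 ≤ d)
    (hy₁ : y₁ 1 ≤ c) (hy₂ : d ≤ y₂ 1) (hW₂ : ∀ u ∈ W₂, a ≤ u 0 ∧ u 0 ≤ b) :
    JoinedIn S x₁ y₁ := by
  obtain ⟨α, hα⟩ := h₁
  obtain ⟨β, hβ⟩ := h₂
  obtain ⟨s, t, hst⟩ := paths_meet α β hx₁ hx₂ (fun s => hW₁ _ (hα s)) hy₁ hy₂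
    (fun t => hW₂ _ (hβ t))
  have key : ∀ {u v : Plane} (γ : Path u v), (∀ r, γ r ∈ S) → ∀ r, JoinedIn S u (γ r) := by
    intro u v γ hγ r
    have h := (((convex_Icc (0 : ℝ) 1).isPathConnected ⟨0, by simp⟩).image
      γ.continuous_extend).joinedIn _ ⟨0, by simp, γ.extend_zero⟩ _ ⟨r, r.2, γ.extend_apply r.2⟩
    refine h.mono ?_
    rintro _ ⟨q, hq, rfl⟩
    exact γ.extend_apply hq ▸ hγ ⟨q, hq⟩
  exact (key α (fun r => hS₁ (hα r)) s).trans (hst ▸ (key β (fun r => hS₂ (hβ r)) t).symm)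

/-! ### Connections through finitely many discs -/

/-- Some point of `A` is connected to some point of `B` by a curve in `O ∩ W`. -/
def Linked (W A B O : Set Plane) : Prop := ∃ x ∈ A, ∃ y ∈ B, JoinedIn (O ∩ W) x y

lemma Linked.mono {W W' A A' B B' O O' : Set Plane} (hW : W ⊆ W') (hA : A ⊆ A') (hB : B ⊆ B')
    (hO : O ⊆ O') (h : Linked W A B O) : Linked W' A' B' O' := by
  obtain ⟨x, hx, y, hy, h⟩ := h
  exact ⟨x, hA hx, y, hB hy, h.mono (Set.inter_subset_inter hO hW)⟩

/-- Two points of a finite union of closed convex sets belong to the same path component if and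
only if there is a chain of successively intersecting sets from one to the other. -/
lemma joinedIn_biUnion_iff {ι : Type*} {s : Set ι} (hs : s.Finite) {C : ι → Set Plane}
    (hcl : ∀ i, IsClosed (C i)) (hconv : ∀ i, Convex ℝ (C i)) {x y : Plane} :
    JoinedIn (⋃ i ∈ s, C i) x y ↔ ∃ i ∈ s, ∃ j ∈ s, x ∈ C i ∧ y ∈ C j ∧
      Relation.ReflTransGen (fun i j => j ∈ s ∧ (C i ∩ C j).Nonempty) i j := by
  constructor
  · intro h
    obtain ⟨i, hi, hxi⟩ := Set.mem_iUnion₂.1 h.source_mem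
    refine ⟨i, hi, ?_⟩
    set r := fun i j => j ∈ s ∧ (C i ∩ C j).Nonempty
    obtain ⟨γ, hγ⟩ := h
    -- The discs reachable from `i` and the others form a separation of the curve.
    set U := ⋃ j ∈ s ∩ {j | Relation.ReflTransGen r i j}, C j
    set V := ⋃ j ∈ s ∩ {j | ¬ Relation.ReflTransGen r i j}, C j
    have hU : IsClosed U := (hs.inter_of_left _).isClosed_biUnion fun j _ => hcl j
    have hV : IsClosed V := (hs.inter_of_left _).isClosed_biUnion fun j _ => hcl j
    have hpre : IsPreconnected (Set.range γ) := isPreconnected_range γ.continuous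
    have hcov : Set.range γ ⊆ U ∪ V := by
      rintro _ ⟨t, rfl⟩
      obtain ⟨j, hj, hm⟩ := Set.mem_iUnion₂.1 (hγ t)
      by_cases hr : Relation.ReflTransGen r i j
      · exact Or.inl (Set.mem_biUnion (show j ∈ s ∩ _ from ⟨hj, hr⟩) hm)
      · exact Or.inr (Set.mem_biUnion (show j ∈ s ∩ _ from ⟨hj, hr⟩) hm)
    have hdis : Set.range γ ∩ (U ∩ V) = ∅ := by
      rw [Set.eq_empty_iff_forall_notMem]
      rintro u ⟨-, hu, hv⟩
      obtain ⟨j, ⟨hj, hrj⟩, huj⟩ := Set.mem_iUnion₂.1 hu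
      obtain ⟨k, ⟨hk, hrk⟩, huk⟩ := Set.mem_iUnion₂.1 hv
      exact hrk (hrj.tail ⟨hk, ⟨u, huj, huk⟩⟩)
    rcases isPreconnected_iff_subset_of_disjoint_closed.1 hpre U V hU hV hcov hdis with h | h
    · obtain ⟨j, ⟨hj, hrj⟩, hyj⟩ := Set.mem_iUnion₂.1 (h ⟨1, γ.target⟩)
      exact ⟨j, hj, hxi, hyj, hrj⟩
    · exfalso
      have hxU : x ∈ U := Set.mem_biUnion (show i ∈ s ∩ _ from ⟨hi, .refl⟩) hxi
      have : x ∈ Set.range γ ∩ (U ∩ V) := ⟨⟨0, γ.source⟩, hxU, h ⟨0, γ.source⟩⟩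
      rw [hdis] at this
      exact this
  · rintro ⟨i, hi, j, -, hx, hy, hr⟩
    have hsub : ∀ k ∈ s, C k ⊆ ⋃ i ∈ s, C i := fun k hk => Set.subset_biUnion_of_mem hk
    have hjoin : ∀ k ∈ s, ∀ u ∈ C k, ∀ v ∈ C k, JoinedIn (⋃ i ∈ s, C i) u v :=
      fun k hk u hu v hv =>
        JoinedIn.mono (((hconv k).isPathConnected ⟨u, hu⟩).joinedIn u hu v hv) (hsub k hk)
    suffices ∀ k, Relation.ReflTransGen (fun i j => j ∈ s ∧ (C i ∩ C j).Nonempty) i k →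
        k ∈ s ∧ ∀ v ∈ C k, JoinedIn (⋃ i ∈ s, C i) x v from (this j hr).2 y hy
    intro k hk
    induction hk with
    | refl => exact ⟨hi, fun v hv => hjoin i hi x hx v hv⟩
    | tail _ h ih =>
      obtain ⟨hcs, w, hw₁, hw₂⟩ := h
      exact ⟨hcs, fun v hv => (ih.2 w hw₁).trans (hjoin _ hcs w hw₂ v hv)⟩

/-- The projection of a closed set along a compact set is closed. -/
lemma isClosed_exists_mem_compact {X Y : Type*} [TopologicalSpace X] [TopologicalSpace Y]
    {K : Set Y} (hK : IsCompact K) {S : Set (X × Y)} (hS : IsClosed S) :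
    IsClosed {x | ∃ u ∈ K, (x, u) ∈ S} := by
  have := isCompact_iff_compactSpace.1 hK
  have h : IsClosed ((fun p : X × K => (p.1, (p.2 : Y))) ⁻¹' S) := hS.preimage (by fun_prop)
  convert! isClosedMap_fst_of_compactSpace _ h using 1
  ext x
  constructor
  · rintro ⟨u, hu, hx⟩
    exact ⟨(x, ⟨u, hu⟩), hx, rfl⟩
  · rintro ⟨⟨x', u⟩, hx, rfl⟩
    exact ⟨u, u.2, hx⟩

section Measurability

variable {Z ι : Type*} [MeasurableSpace Z] [MeasurableSpace ι]

/-- If the random set `ξ` is the support of an s-finite kernel, then existential quantification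
over `ξ` preserves measurability. -/
lemma measurableSet_exists_mem {ξ : Z → Set ι} (κ : Kernel Z ι) [IsSFiniteKernel κ]
    (hκ : ∀ z S, MeasurableSet S → (κ z S ≠ 0 ↔ (ξ z ∩ S).Nonempty))
    {Y : Type*} [MeasurableSpace Y] {π : Y → Z} (hπ : Measurable π) {S : Set (Y × ι)}
    (hS : MeasurableSet S) : MeasurableSet {y | ∃ q ∈ ξ (π y), (y, q) ∈ S} := by
  have h := Kernel.measurable_kernel_prodMk_left (κ := κ.comap π hπ) hS
  have h2 : {y | ∃ q ∈ ξ (π y), (y, q) ∈ S} =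
      {y | (κ.comap π hπ) y (Prod.mk y ⁻¹' S) ≠ 0} := by
    ext y
    simp only [Set.mem_ofPred_eq, Kernel.comap_apply]
    rw [hκ _ _ (measurable_prodMk_left hS)]
    rfl
  rw [h2]
  exact h (measurableSet_singleton 0).compl

/-- The pairs `(z, j)` such that there is a `J`-chain `i₀, …, iₙ = j` with `i₀, …, iₙ₋₁` in `ξ z`
and `i₀` satisfying `T`. -/
def chainSet (ξ : Z → Set ι) (T : Set (Z × ι)) (J : Set ((Z × ι) × ι)) : ℕ → Set (Z × ι)
  | 0 => T
  | n + 1 => {p | ∃ i ∈ ξ p.1, (p.1, i) ∈ chainSet ξ T J n ∧ (p, i) ∈ J}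

lemma measurableSet_chainSet {ξ : Z → Set ι} (κ : Kernel Z ι) [IsSFiniteKernel κ]
    (hκ : ∀ z S, MeasurableSet S → (κ z S ≠ 0 ↔ (ξ z ∩ S).Nonempty))
    {T : Set (Z × ι)} (hT : MeasurableSet T) {J : Set ((Z × ι) × ι)} (hJ : MeasurableSet J)
    (n : ℕ) : MeasurableSet (chainSet ξ T J n) := by
  induction n with
  | zero => exact hT
  | succ n ih =>
    have h : MeasurableSet ((fun p : (Z × ι) × ι => (p.1.1, p.2)) ⁻¹' chainSet ξ T J n ∩ J) :=
      (ih.preimage (by fun_prop)).inter hJ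
    exact measurableSet_exists_mem κ hκ measurable_fst h

/-- The event that two closed sets are linked by a finite random family of discs, inside a compact
convex window, is measurable: connections are finite chains of intersecting discs, and for discs to
intersect inside the window is a closed condition on their centres and radii. -/
lemma measurableSet_linked {ξ : Z → Set ι} (hfin : ∀ z, (ξ z).Finite) (κ : Kernel Z ι)
    [IsSFiniteKernel κ] (hκ : ∀ z S, MeasurableSet S → (κ z S ≠ 0 ↔ (ξ z ∩ S).Nonempty))
    {pos : ι → Plane} (hpos : Measurable pos) {ρ : Z → ι → ℝ≥0}
    (hρ : Measurable (Function.uncurry ρ)) {W A B : Set Plane} (hW : IsCompact W)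
    (hWc : Convex ℝ W) (hA : IsClosed A) (hB : IsClosed B) :
    MeasurableSet {z | Linked W A B (⋃ i ∈ ξ z, Metric.closedBall (pos i) (ρ z i))} := by
  set C : Z → ι → Set Plane := fun z i => Metric.closedBall (pos i) (ρ z i) ∩ W with hC
  have hρ' : Measurable fun p : Z × ι => ρ p.1 p.2 := hρ
  have touch : ∀ K : Set Plane, IsClosed K → MeasurableSet {p : Z × ι | (C p.1 p.2 ∩ K).Nonempty} := by
    intro K hK
    have hS : IsClosed {q : (Plane × ℝ≥0) × Plane | dist q.2 q.1.1 ≤ q.1.2} :=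
      isClosed_le (by fun_prop) (by fun_prop)
    have h := (isClosed_exists_mem_compact (hW.inter_right hK) hS).measurableSet
    have hm : Measurable fun p : Z × ι => (pos p.2, ρ p.1 p.2) := by fun_prop
    convert! hm h using 1
    ext p
    simp only [hC, Set.Nonempty, Set.mem_inter_iff, Metric.mem_closedBall, Set.mem_ofPred_eq,
      Set.mem_preimage]
    exact exists_congr fun u => by tauto
  have join : MeasurableSet {p : (Z × ι) × ι | (C p.1.1 p.2 ∩ C p.1.1 p.1.2).Nonempty} := by
    have hS : IsClosed {q : ((Plane × ℝ≥0) × Plane × ℝ≥0) × Plane |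
        dist q.2 q.1.1.1 ≤ q.1.1.2 ∧ dist q.2 q.1.2.1 ≤ q.1.2.2} :=
      by
      rw [Set.ofPred_and]
      exact (isClosed_le (by fun_prop) (by fun_prop)).inter (isClosed_le (by fun_prop) (by fun_prop))
    have h := (isClosed_exists_mem_compact hW hS).measurableSet
    have h1 : Measurable fun p : (Z × ι) × ι => ρ p.1.1 p.2 :=
      hρ'.comp (measurable_fst.fst.prodMk measurable_snd)
    have h2 : Measurable fun p : (Z × ι) × ι => ρ p.1.1 p.1.2 := hρ'.comp measurable_fst
    have hm : Measurable fun p : (Z × ι) × ι =>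
        ((pos p.2, ρ p.1.1 p.2), (pos p.1.2, ρ p.1.1 p.1.2)) := by fun_prop
    convert! hm h using 1
    ext p
    simp only [hC, Set.Nonempty, Set.mem_inter_iff, Metric.mem_closedBall, Set.mem_ofPred_eq,
      Set.mem_preimage]
    exact exists_congr fun u => by tauto
  set R := chainSet ξ {p : Z × ι | (C p.1 p.2 ∩ A).Nonempty}
    {p : (Z × ι) × ι | (C p.1.1 p.2 ∩ C p.1.1 p.1.2).Nonempty} with hR
  have hRm : ∀ n, MeasurableSet (R n) := measurableSet_chainSet κ hκ (touch A hA) join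
  have key : {z | Linked W A B (⋃ i ∈ ξ z, Metric.closedBall (pos i) (ρ z i))} =
      ⋃ n, {z | ∃ j ∈ ξ z, (z, j) ∈ R n ∩ {p : Z × ι | (C p.1 p.2 ∩ B).Nonempty}} := by
    ext z
    have hz : ∀ x y, JoinedIn ((⋃ i ∈ ξ z, Metric.closedBall (pos i) (ρ z i)) ∩ W) x y ↔
        ∃ i ∈ ξ z, ∃ j ∈ ξ z, x ∈ C z i ∧ y ∈ C z j ∧ Relation.ReflTransGen
          (fun i j => j ∈ ξ z ∧ (C z i ∩ C z j).Nonempty) i j :=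
      fun x y => by
        rw [Set.iUnion₂_inter]
        exact joinedIn_biUnion_iff (hfin z) (C := C z)
          (fun i => Metric.isClosed_closedBall.inter hW.isClosed)
          (fun i => (convex_closedBall _ _).inter hWc)
    simp only [Linked, Set.mem_ofPred_eq, Set.mem_iUnion, hz]
    constructor
    · rintro ⟨x, hx, y, hy, i, hi, j, hj, hxi, hyj, hr⟩
      suffices ∀ k, Relation.ReflTransGen
          (fun i j => j ∈ ξ z ∧ (C z i ∩ C z j).Nonempty) i k → k ∈ ξ z ∧ ∃ n, (z, k) ∈ R n by
        obtain ⟨-, n, hn⟩ := this j hr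
        exact ⟨n, j, hj, hn, ⟨y, hyj, hy⟩⟩
      intro k hk
      induction hk with
      | refl => exact ⟨hi, 0, ⟨x, hxi, hx⟩⟩
      | tail _ h ih =>
        obtain ⟨hb, n, hn⟩ := ih
        exact ⟨h.1, n + 1, _, hb, hn, h.2⟩
    · rintro ⟨n, j, hj, hn, y, hyj, hy⟩
      suffices ∀ n k, k ∈ ξ z → (z, k) ∈ R n → ∃ x ∈ A, ∃ i ∈ ξ z, x ∈ C z i ∧
          Relation.ReflTransGen (fun i j => j ∈ ξ z ∧ (C z i ∩ C z j).Nonempty) i k by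
        obtain ⟨x, hx, i, hi, hxi, hr⟩ := this n j hj hn
        exact ⟨x, hx, y, hy, i, hi, j, hj, hxi, hyj, hr⟩
      intro n
      induction n with
      | zero =>
        rintro k hk ⟨x, hxk, hx⟩
        exact ⟨x, hx, k, hk, hxk, .refl⟩
      | succ n ih =>
        rintro k hk ⟨l, hl, hln, hne⟩
        obtain ⟨x, hx, i, hi, hxi, hr⟩ := ih l hl hln
        exact ⟨x, hx, i, hi, hxi, hr.tail ⟨hk, hne⟩⟩
  rw [key]
  refine MeasurableSet.iUnion fun n => ?_
  exact measurableSet_exists_mem κ hκ measurable_id ((hRm n).inter (touch B hB))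

/-- Deterministic centres: the radii for which finitely many discs link two sets form a measurable
set. -/
lemma measurableSet_linked_radii {k : ℕ} (y : Fin k → Plane) {W A B : Set Plane}
    (hW : IsCompact W) (hWc : Convex ℝ W) (hA : IsClosed A) (hB : IsClosed B) :
    MeasurableSet {r : Fin k → ℝ≥0 | Linked W A B (⋃ i, Metric.closedBall (y i) (r i))} := by
  have h := measurableSet_linked (Z := Fin k → ℝ≥0) (ξ := fun _ => (Set.univ : Set (Fin k)))
    (fun _ => Set.finite_univ) (Kernel.const _ Measure.count)
    (fun z S _ => by
      rw [Kernel.const_apply, Set.univ_inter, ne_eq, Measure.count_eq_zero_iff,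
        Set.nonempty_iff_ne_empty])
    (pos := y) (measurable_of_finite y) (ρ := fun r i => r i)
    (measurable_from_prod_countable_left fun i => by
      simpa [Function.uncurry] using measurable_pi_apply i) hW hWc hA hB
  simpa using h

end Measurability

/-! ### Finite configurations -/

/-- The finite configurations of marked points. Every event of bounded range depends on the
Poisson process only through such a configuration. -/
structure FinConf where
  /-- The points of the configuration. -/
  points : Set (Plane × unitInterval)
  finite : points.Finite

/-- The numbers of points of a configuration in all Borel sets. -/
noncomputable def FinConf.counts (s : FinConf) (A : {A : Set (Plane × unitInterval) // MeasurableSet A}) : ℕ∞ :=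
  (s.points ∩ A.1).encard

/-- The sigma algebra generated by the numbers of points in Borel sets. -/
noncomputable instance : MeasurableSpace FinConf := MeasurableSpace.comap FinConf.counts MeasurableSpace.pi

lemma FinConf.measurable_counts : Measurable FinConf.counts := comap_measurable _

lemma FinConf.measurable_encard {A : Set (Plane × unitInterval)} (hA : MeasurableSet A) :
    Measurable fun s : FinConf => (s.points ∩ A).encard :=
  (measurable_pi_apply (⟨A, hA⟩ : {A : Set (Plane × unitInterval) // MeasurableSet A})).comp
    FinConf.measurable_counts

/-- The kernel that maps a configuration to the counting measure on it. -/
noncomputable def FinConf.countKernel : Kernel FinConf (Plane × unitInterval) where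
  toFun s := Measure.count.restrict s.points
  measurable' := by
    refine Measure.measurable_of_measurable_coe _ fun A hA => ?_
    have : (fun s : FinConf => Measure.count.restrict s.points A) =
        fun s : FinConf => (((s.points ∩ A).encard : ℕ∞) : ℝ≥0∞) := by
      funext s
      rw [Measure.restrict_apply hA, Measure.count_apply (hA.inter s.finite.measurableSet),
        Set.inter_comm]
    rw [this]
    exact (Measurable.of_discrete (f := fun n : ℕ∞ => (n : ℝ≥0∞))).comp
      (FinConf.measurable_encard hA)

lemma FinConf.countKernel_apply (s : FinConf) {A : Set (Plane × unitInterval)}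
    (hA : MeasurableSet A) : FinConf.countKernel s A = (((s.points ∩ A).encard : ℕ∞) : ℝ≥0∞) := by
  change Measure.count.restrict s.points A = _
  rw [Measure.restrict_apply hA, Measure.count_apply (hA.inter s.finite.measurableSet), Set.inter_comm]

lemma FinConf.countKernel_ne_zero (s : FinConf) {A : Set (Plane × unitInterval)}
    (hA : MeasurableSet A) : FinConf.countKernel s A ≠ 0 ↔ (s.points ∩ A).Nonempty := by
  rw [FinConf.countKernel_apply s hA, ← Set.encard_ne_zero]
  simp

instance : IsSFiniteKernel FinConf.countKernel := by
  classical
  have hm : ∀ k : ℕ, MeasurableSet {s : FinConf | (s.points ∩ Set.univ).encard = k} := fun k =>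
    FinConf.measurable_encard MeasurableSet.univ (measurableSet_singleton (k : ℕ∞))
  have hsum : FinConf.countKernel =
      Kernel.sum fun k : ℕ => Kernel.piecewise (hm k) FinConf.countKernel 0 := by
    ext s A hA
    obtain ⟨k, hk⟩ := ENat.ne_top_iff_exists.1
      (Set.encard_ne_top_iff.2 (s.finite.inter_of_left Set.univ))
    rw [Kernel.sum_apply' _ _ hA, tsum_eq_single k]
    · rw [Kernel.piecewise_apply, if_pos (show s ∈ {t : FinConf | (t.points ∩ Set.univ).encard = k} from
        hk.symm)]
    · intro j hj
      rw [Kernel.piecewise_apply, if_neg]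
      · simp
      · intro h
        rw [Set.mem_ofPred_eq, ← hk] at h
        exact hj (Nat.cast_injective h).symm
  rw [hsum]
  have : ∀ k, IsFiniteKernel (Kernel.piecewise (hm k) FinConf.countKernel 0) := by
    intro k
    refine ⟨⟨k, ENNReal.natCast_lt_top k, fun s => ?_⟩⟩
    rw [Kernel.piecewise_apply]
    split_ifs with h
    · rw [FinConf.countKernel_apply s MeasurableSet.univ, h]
      simp
    · simp
  infer_instance

/-! ### The Poisson process in bounded windows -/

section Poisson

variable {Ω : Type*} [MeasurableSpace Ω] {μ : Measure Ω} {lam : ℝ≥0}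
  {η : Ω → Set (Plane × unitInterval)}

/-- The marked points whose spatial component belongs to `T`. -/
def slab (T : Set Plane) : Set (Plane × unitInterval) := {p | p.1 ∈ T}

lemma measurableSet_slab {T : Set Plane} (hT : MeasurableSet T) : MeasurableSet (slab T) :=
  hT.preimage measurable_fst

lemma volume_slab_ne_top {T : Set Plane} (hT : Bornology.IsBounded T) : volume (slab T) ≠ ∞ := by
  have : slab T = T ×ˢ Set.univ := by ext p; simp [slab]
  rw [this, Measure.volume_eq_prod, Measure.prod_prod]
  exact ENNReal.mul_ne_top hT.measure_lt_top.ne (measure_ne_top _ _)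

lemma IsPoissonProcess.finite_slab (hη : IsPoissonProcess μ lam η) {T : Set Plane}
    (hT : Bornology.IsBounded T) (ω : Ω) : (η ω ∩ slab T).Finite := by
  refine (hη.finite_inter ω (closure T ×ˢ Set.univ)
    (hT.isCompact_closure.prod isCompact_univ)).subset ?_
  exact Set.inter_subset_inter_right _ fun p hp => ⟨subset_closure hp, trivial⟩

/-- The restriction of the point process to the points with spatial component in the bounded
set `T`. -/
def IsPoissonProcess.window (hη : IsPoissonProcess μ lam η) {T : Set Plane}
    (hT : Bornology.IsBounded T) (ω : Ω) : FinConf := ⟨η ω ∩ slab T, hη.finite_slab hT ω⟩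

lemma IsPoissonProcess.measurable_window (hη : IsPoissonProcess μ lam η) {T : Set Plane}
    (hT : Bornology.IsBounded T) (hTm : MeasurableSet T) : Measurable (hη.window hT) := by
  rw [measurable_comap_iff]
  refine measurable_pi_lambda _ fun A => ?_
  have := hη.measurable_count _ ((measurableSet_slab hTm).inter A.2)
  simp only [← Set.inter_assoc] at this
  exact this

/-- The independence of the numbers of points, for an arbitrary finite index set. -/
lemma IsPoissonProcess.iIndepFun_count (hη : IsPoissonProcess μ lam η) {κ : Type*} [Fintype κ]
    {A : κ → Set (Plane × unitInterval)} (hA : ∀ i, MeasurableSet (A i))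
    (hd : Pairwise fun i j => Disjoint (A i) (A j)) :
    iIndepFun (fun i ω => (η ω ∩ A i).encard) μ := by
  let e := Fintype.equivFin κ
  have h := hη.count_indep (Fintype.card κ) (A ∘ e.symm) (fun i => hA _)
    (fun i j hij => hd fun h => hij (e.symm.injective h))
  have h2 := h.precomp e.injective
  simpa [Function.comp_def] using h2

/-- The points of `slab T` that belong to precisely those of the sets `A i` that `σ` selects. -/
def atom {ι : Type*} (T : Set Plane) (A : ι → Set (Plane × unitInterval)) (σ : ι → Bool) :
    Set (Plane × unitInterval) := slab T ∩ {p | ∀ i, p ∈ A i ↔ σ i = true}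

lemma measurableSet_atom {ι : Type*} [Finite ι] {T : Set Plane} (hT : MeasurableSet T)
    {A : ι → Set (Plane × unitInterval)} (hA : ∀ i, MeasurableSet (A i)) (σ : ι → Bool) :
    MeasurableSet (atom T A σ) := by
  refine (measurableSet_slab hT).inter ?_
  rw [Set.ofPred_forall]
  refine MeasurableSet.iInter fun i => ?_
  cases h : σ i
  · convert! (hA i).compl using 1
    ext p
    simp
  · convert! hA i using 1
    ext p
    simp

lemma pairwise_disjoint_atom {ι : Type*} (T : Set Plane) (A : ι → Set (Plane × unitInterval)) :
    Pairwise fun σ τ => Disjoint (atom T A σ) (atom T A τ) := by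
  intro σ τ hne
  rw [Set.disjoint_left]
  rintro p ⟨-, h1⟩ ⟨-, h2⟩
  refine hne (funext fun i => ?_)
  rw [Bool.eq_iff_iff, ← h1 i, ← h2 i]

lemma encard_inter_eq_sum_atom {ι : Type*} [Fintype ι] [DecidableEq ι] (T : Set Plane)
    (A : ι → Set (Plane × unitInterval)) (s : Set (Plane × unitInterval)) (i : ι) :
    (s ∩ slab T ∩ A i).encard =
      ∑ σ : ι → Bool, if σ i = true then (s ∩ atom T A σ).encard else 0 := by
  classical
  have h : s ∩ slab T ∩ A i =
      ⋃ σ : ι → Bool, if σ i = true then s ∩ atom T A σ else ∅ := by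
    ext p
    simp only [Set.mem_iUnion]
    constructor
    · rintro ⟨⟨hs, hT⟩, hi⟩
      refine ⟨fun j => decide (p ∈ A j), ?_⟩
      rw [if_pos (by simpa using hi)]
      exact ⟨hs, hT, fun j => by simp⟩
    · rintro ⟨σ, hσ⟩
      split_ifs at hσ with h
      · exact ⟨⟨hσ.1, hσ.2.1⟩, (hσ.2.2 i).2 h⟩
      · exact hσ.elim
  rw [h, Set.encard_iUnion_of_finite, finsum_eq_sum_of_fintype]
  · refine Finset.sum_congr rfl fun σ _ => ?_
    split_ifs <;> simp
  · intro σ τ hne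
    have := pairwise_disjoint_atom T A hne
    simp only [Function.onFun]
    split_ifs
    · exact this.mono Set.inter_subset_right Set.inter_subset_right
    all_goals simp

/-- The numbers of points in the sets `A i`, as a function of those in the atoms. -/
noncomputable def sumAtoms {ι : Type*} [Fintype ι] [DecidableEq ι] (N : (ι → Bool) → ℕ∞) (i : ι) : ℕ∞ :=
  ∑ σ : ι → Bool, if σ i = true then N σ else 0

lemma measurable_sumAtoms {ι : Type*} [Fintype ι] [DecidableEq ι] :
    Measurable (sumAtoms (ι := ι)) :=
  measurable_of_countable _

/-- The law of a Poisson process in a bounded window is determined by its intensity. -/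
lemma IsPoissonProcess.map_window_eq {Ω₁ : Type*} [MeasurableSpace Ω₁] {μ₁ : Measure Ω₁}
    {η₁ : Ω₁ → Set (Plane × unitInterval)} [IsProbabilityMeasure μ] [IsProbabilityMeasure μ₁]
    (hη : IsPoissonProcess μ lam η) (hη₁ : IsPoissonProcess μ₁ lam η₁) {T : Set Plane}
    (hT : Bornology.IsBounded T) (hTm : MeasurableSet T) :
    μ.map (hη.window hT) = μ₁.map (hη₁.window hT) := by
  classical
  have hw := hη.measurable_window hT hTm
  have hw₁ := hη₁.measurable_window hT hTm
  have := Measure.isProbabilityMeasure_map (μ := μ) hw.aemeasurable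
  have := Measure.isProbabilityMeasure_map (μ := μ₁) hw₁.aemeasurable
  have hc := FinConf.measurable_counts
  -- It suffices to compare the joint laws of the numbers of points in finitely many sets.
  suffices h : (μ.map (hη.window hT)).map FinConf.counts =
      (μ₁.map (hη₁.window hT)).map FinConf.counts by
    ext E hE
    obtain ⟨S, hS, rfl⟩ := hE
    rw [← Measure.map_apply hc hS, ← Measure.map_apply hc hS, h]
  have := Measure.isProbabilityMeasure_map (μ := μ.map (hη.window hT)) hc.aemeasurable
  have := Measure.isProbabilityMeasure_map (μ := μ₁.map (hη₁.window hT)) hc.aemeasurable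
  refine IsProjectiveLimit.unique (P := fun I =>
    ((μ.map (hη.window hT)).map FinConf.counts).map I.restrict) (fun I => rfl) fun I => ?_
  beta_reduce
  rw [Measure.map_map (Finset.measurable_restrict I) hc, Measure.map_map (by fun_prop) hw₁,
    Measure.map_map (Finset.measurable_restrict I) hc, Measure.map_map (by fun_prop) hw]
  set A : I → Set (Plane × unitInterval) := fun i => i.1.1
  have hA : ∀ i, MeasurableSet (A i) := fun i => i.1.2
  have hat := measurableSet_atom hTm hA
  have e : (I.restrict ∘ FinConf.counts) ∘ hη.window hT =
      sumAtoms ∘ fun ω σ => (η ω ∩ atom T A σ).encard := by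
    funext ω i
    exact encard_inter_eq_sum_atom T A (η ω) i
  have e₁ : (I.restrict ∘ FinConf.counts) ∘ hη₁.window hT =
      sumAtoms ∘ fun ω σ => (η₁ ω ∩ atom T A σ).encard := by
    funext ω i
    exact encard_inter_eq_sum_atom T A (η₁ ω) i
  have hN : ∀ σ, Measurable fun ω => (η ω ∩ atom T A σ).encard :=
    fun σ => hη.measurable_count _ (hat σ)
  have hN₁ : ∀ σ, Measurable fun ω => (η₁ ω ∩ atom T A σ).encard :=
    fun σ => hη₁.measurable_count _ (hat σ)
  rw [e, e₁, ← Measure.map_map measurable_sumAtoms (measurable_pi_lambda _ hN),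
    ← Measure.map_map measurable_sumAtoms (measurable_pi_lambda _ hN₁),
    (hη.iIndepFun_count hat (pairwise_disjoint_atom T A)).map_fun_eq_pi_map
      (fun σ => (hN σ).aemeasurable),
    (hη₁.iIndepFun_count hat (pairwise_disjoint_atom T A)).map_fun_eq_pi_map
      (fun σ => (hN₁ σ).aemeasurable)]
  congr 2
  funext σ
  refine Measure.ext_of_singleton fun k => ?_
  rw [Measure.map_apply (hN₁ σ) (measurableSet_singleton _),
    Measure.map_apply (hN σ) (measurableSet_singleton _)]
  have hvol : volume (atom T A σ) ≠ ∞ :=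
    ne_top_of_le_ne_top (volume_slab_ne_top hT) (measure_mono Set.inter_subset_left)
  induction k with
  | top =>
    have hfin : ∀ s : Set (Plane × unitInterval), (s ∩ slab T).Finite →
        (s ∩ atom T A σ).encard ≠ ⊤ := fun s hs =>
      Set.encard_ne_top_iff.2 (hs.subset (Set.inter_subset_inter_right _ Set.inter_subset_left))
    have h0 : (fun ω => (η ω ∩ atom T A σ).encard) ⁻¹' {⊤} = ∅ :=
      Set.eq_empty_of_forall_notMem fun ω h => hfin _ (hη.finite_slab hT ω) h
    have h1 : (fun ω => (η₁ ω ∩ atom T A σ).encard) ⁻¹' {⊤} = ∅ :=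
      Set.eq_empty_of_forall_notMem fun ω h => hfin _ (hη₁.finite_slab hT ω) h
    rw [h0, h1, measure_empty, measure_empty]
  | coe k => exact (hη₁.count_law _ (hat σ) hvol k).trans (hη.count_law _ (hat σ) hvol k).symm

/-- The restrictions of a Poisson process to disjoint bounded windows are independent. -/
lemma IsPoissonProcess.indepFun_window [IsProbabilityMeasure μ] (hη : IsPoissonProcess μ lam η)
    {T T' : Set Plane} (hT : Bornology.IsBounded T) (hTm : MeasurableSet T)
    (hT' : Bornology.IsBounded T') (hTm' : MeasurableSet T') (hd : Disjoint T T') :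
    IndepFun (hη.window hT) (hη.window hT') μ := by
  classical
  have hw := hη.measurable_window hT hTm
  have hw' := hη.measurable_window hT' hTm'
  have key : IndepFun (fun ω A => (hη.window hT ω).counts A)
      (fun ω A => (hη.window hT' ω).counts A) μ := by
    refine IndepFun.process_indepFun_process
      (fun A => (measurable_pi_apply A).comp (FinConf.measurable_counts.comp hw))
      (fun A => (measurable_pi_apply A).comp (FinConf.measurable_counts.comp hw')) fun I J => ?_
    set A : I → Set (Plane × unitInterval) := fun i => i.1.1
    have hA : ∀ i, MeasurableSet (A i) := fun i => i.1.2
    set B : J → Set (Plane × unitInterval) := fun i => i.1.1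
    have hB : ∀ i, MeasurableSet (B i) := fun i => i.1.2
    set D : (I → Bool) ⊕ (J → Bool) → Set (Plane × unitInterval) :=
      Sum.elim (atom T A) (atom T' B) with hD
    have hDm : ∀ i, MeasurableSet (D i) := by
      rintro (σ | σ)
      · exact measurableSet_atom hTm hA σ
      · exact measurableSet_atom hTm' hB σ
    have hcross : ∀ σ τ, Disjoint (atom T A σ) (atom T' B τ) := fun σ τ =>
      (hd.preimage Prod.fst).mono Set.inter_subset_left Set.inter_subset_left
    have hDd : Pairwise fun i j => Disjoint (D i) (D j) := by
      rintro (σ | σ) (τ | τ) hne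
      · exact pairwise_disjoint_atom T A fun h => hne (h ▸ rfl)
      · exact hcross σ τ
      · exact (hcross τ σ).symm
      · exact pairwise_disjoint_atom T' B fun h => hne (h ▸ rfl)
    set L : Finset ((I → Bool) ⊕ (J → Bool)) := Finset.univ.image Sum.inl with hL
    set R : Finset ((I → Bool) ⊕ (J → Bool)) := Finset.univ.image Sum.inr with hR
    have hind := (hη.iIndepFun_count hDm hDd).indepFun_finset
      L R (by rw [Finset.disjoint_left]; simp [hL, hR])
      (fun i => hη.measurable_count _ (hDm i))
    have h2 := hind.comp
      (φ := fun N : L → ℕ∞ =>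
        sumAtoms fun σ : I → Bool => N ⟨Sum.inl σ, by simp [hL]⟩)
      (ψ := fun N : R → ℕ∞ =>
        sumAtoms fun σ : J → Bool => N ⟨Sum.inr σ, by simp [hR]⟩)
      (measurable_of_countable _) (measurable_of_countable _)
    convert! h2 using 1
    · funext ω i
      exact encard_inter_eq_sum_atom T A (η ω) i
    · funext ω i
      exact encard_inter_eq_sum_atom T' B (η ω) i
  rw [IndepFun_iff] at key ⊢
  rintro _ _ ⟨_, ⟨S, hS, rfl⟩, rfl⟩ ⟨_, ⟨S', hS', rfl⟩, rfl⟩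
  exact key _ _ ⟨S, hS, rfl⟩ ⟨S', hS', rfl⟩

/-- The preimage of a Poisson process under a volume preserving homeomorphism of the plane is a
Poisson process. -/
lemma IsPoissonProcess.preimage (hη : IsPoissonProcess μ lam η) (g : Plane ≃ₜ Plane)
    (hg : MeasurePreserving g volume volume) :
    IsPoissonProcess μ lam fun ω => Prod.map g id ⁻¹' η ω := by
  let G : (Plane × unitInterval) ≃ₜ (Plane × unitInterval) := g.prodCongr (Homeomorph.refl _)
  have hG : MeasurePreserving G volume volume := hg.prod (MeasurePreserving.id _)
  have hGs : MeasurePreserving G.symm volume volume := hG.symm G.toMeasurableEquiv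
  have e : ∀ (s A : Set (Plane × unitInterval)), G ⁻¹' s ∩ A = G ⁻¹' (s ∩ G.symm ⁻¹' A) := by
    intro s A
    ext p
    simp
  have he : ∀ (s A : Set (Plane × unitInterval)),
      (G ⁻¹' s ∩ A).encard = (s ∩ G.symm ⁻¹' A).encard := fun s A => by
    rw [e, Set.encard_preimage_of_bijective G.bijective]
  change IsPoissonProcess μ lam fun ω => G ⁻¹' η ω
  refine ⟨fun ω K hK => ?_, fun A hA => ?_, fun A hA hvol k => ?_, fun m A hA hd => ?_⟩
  · rw [e]
    refine Set.Finite.preimage G.injective.injOn (hη.finite_inter ω _ ?_)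
    exact G.symm.isCompact_preimage.2 hK
  · simp only [he]
    exact hη.measurable_count _ (G.symm.continuous.measurable hA)
  · have hv : volume (G.symm ⁻¹' A) = volume A := hGs.measure_preimage hA.nullMeasurableSet
    simp only [he]
    rw [hη.count_law _ (G.symm.continuous.measurable hA) (hv ▸ hvol), hv]
  · simp only [he]
    exact hη.count_indep m _ (fun i => G.symm.continuous.measurable (hA i))
      fun i j hij => (hd hij).preimage _

end Poisson

/-! ### Local connection events and their symmetries -/

/-- The data of a local connection event: the closed sets `A` and `B` are to be connected by a curve
inside the compact convex set `W`, using the discs with centres in the bounded set `T`. -/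
structure LinkData where
  /-- The window that contains the curve. -/
  W : Set Plane
  /-- The set where the curve starts. -/
  A : Set Plane
  /-- The set where the curve ends. -/
  B : Set Plane
  /-- The set of admissible centres. -/
  T : Set Plane
  compact_W : IsCompact W
  convex_W : Convex ℝ W
  closed_A : IsClosed A
  closed_B : IsClosed B
  bounded_T : Bornology.IsBounded T
  measurable_T : MeasurableSet T

/-- The symmetries of the model: area preserving affine isometries under which the law of the field
is invariant. -/
structure IsSymmetry {Ω' : Type*} [MeasurableSpace Ω'] (ν : Measure Ω') (φ : Ω' → Plane → ℝ≥0)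
    (g : Plane ≃ᵃⁱ[ℝ] Plane) : Prop where
  measurePreserving : MeasurePreserving g volume volume
  identDistrib : ∀ (k : ℕ) (y : Fin k → Plane),
    IdentDistrib (fun ω i => φ ω (g (y i))) (fun ω i => φ ω (y i)) ν ν

/-- The connection event `d`, moved by the inverse of `g`. -/
def LinkData.comap (d : LinkData) (g : Plane ≃ᵃⁱ[ℝ] Plane) : LinkData where
  W := g ⁻¹' d.W
  A := g ⁻¹' d.A
  B := g ⁻¹' d.B
  T := g ⁻¹' d.T
  compact_W := g.toHomeomorph.isCompact_preimage.2 d.compact_W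
  convex_W := d.convex_W.affine_preimage g.toAffineEquiv.toAffineMap
  closed_A := d.closed_A.preimage g.continuous
  closed_B := d.closed_B.preimage g.continuous
  bounded_T := g.isometry.antilipschitz.isBounded_preimage d.bounded_T
  measurable_T := d.measurable_T.preimage g.continuous.measurable

lemma joinedIn_preimage_iff (g : Plane ≃ᵃⁱ[ℝ] Plane) {S : Set Plane} {x y : Plane} :
    JoinedIn (g ⁻¹' S) x y ↔ JoinedIn S (g x) (g y) := by
  constructor
  · rintro ⟨γ, hγ⟩
    exact ⟨γ.map g.continuous, hγ⟩
  · rintro ⟨γ, hγ⟩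
    refine ⟨(γ.map g.symm.continuous).cast (by simp) (by simp), fun t => ?_⟩
    simpa using hγ t

lemma linked_preimage_iff (g : Plane ≃ᵃⁱ[ℝ] Plane) {W A B O : Set Plane} :
    Linked (g ⁻¹' W) (g ⁻¹' A) (g ⁻¹' B) (g ⁻¹' O) ↔ Linked W A B O := by
  simp only [Linked, ← Set.preimage_inter, joinedIn_preimage_iff]
  constructor
  · rintro ⟨x, hx, y, hy, h⟩
    exact ⟨g x, hx, g y, hy, h⟩
  · rintro ⟨x, hx, y, hy, h⟩
    exact ⟨g.symm x, by simpa using hx, g.symm y, by simpa using hy, by simpa using h⟩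

lemma preimage_occupied (g : Plane ≃ᵃⁱ[ℝ] Plane) (s : Set (Plane × unitInterval))
    (f : Plane → ℝ≥0) :
    g ⁻¹' occupied s f = occupied (Prod.map g id ⁻¹' s) (f ∘ g) := by
  ext u
  simp only [occupied, Set.mem_preimage, Set.mem_iUnion, Metric.mem_closedBall, exists_prop,
    Prod.exists, Prod.map_apply, id, Function.comp_apply]
  constructor
  · rintro ⟨x, z, hs, hd⟩
    refine ⟨g.symm x, z, by simpa using hs, ?_⟩
    rw [← g.dist_map]
    simpa using hd
  · rintro ⟨x, z, hs, hd⟩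
    exact ⟨g x, z, hs, by rwa [g.dist_map]⟩

lemma exists_fin_occupied {s : Set (Plane × unitInterval)} (hs : s.Finite) :
    ∃ (k : ℕ) (y : Fin k → Plane), (∀ i, ∃ p ∈ s, p.1 = y i) ∧
      ∀ f : Plane → ℝ≥0, occupied s f = ⋃ i, Metric.closedBall (y i) (f (y i)) := by
  obtain ⟨k, e, he⟩ := hs.fin_embedding
  refine ⟨k, fun i => (e i).1, fun i => ⟨e i, he ▸ Set.mem_range_self i, rfl⟩, fun f => ?_⟩
  rw [occupied, ← he, Set.biUnion_range]

section Events

variable {Ω Ω' : Type*} {η : Ω → Set (Plane × unitInterval)} {φ : Ω' → Plane → ℝ≥0}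

/-- The connection event, as an event for the point process and the field. -/
def LinkData.event (d : LinkData) (η : Ω → Set (Plane × unitInterval)) (φ : Ω' → Plane → ℝ≥0) :
    Set (Ω × Ω') :=
  {w | Linked d.W d.A d.B (occupiedFrom d.T (η w.1) (φ w.2))}

/-- The connection event, for a fixed configuration of points. -/
def LinkData.fieldEvent (d : LinkData) (φ : Ω' → Plane → ℝ≥0) (s : Set (Plane × unitInterval)) :
    Set Ω' :=
  {ω | Linked d.W d.A d.B (occupied s (φ ω))}

/-- The connection event, as an event for a finite configuration and the field. -/
def LinkData.confEvent (d : LinkData) (φ : Ω' → Plane → ℝ≥0) : Set (FinConf × Ω') :=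
  {w | Linked d.W d.A d.B (occupied w.1.points (φ w.2))}

lemma LinkData.preimage_mk_event (d : LinkData) (ω : Ω) :
    Prod.mk ω ⁻¹' d.event η φ = d.fieldEvent φ (η ω ∩ slab d.T) := rfl

/-- For fixed centres, a connection event is an event for finitely many radii. -/
lemma LinkData.exists_fieldEvent_eq (d : LinkData) {s : Set (Plane × unitInterval)}
    (hs : s.Finite) : ∃ (k : ℕ) (y : Fin k → Plane), (∀ i, ∃ p ∈ s, p.1 = y i) ∧
      ∃ C : Set (Fin k → ℝ≥0), MeasurableSet C ∧ ∀ ψ : Ω' → Plane → ℝ≥0,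
        d.fieldEvent ψ s = {ω | (fun i => ψ ω (y i)) ∈ C} := by
  obtain ⟨k, y, hy, hocc⟩ := exists_fin_occupied hs
  refine ⟨k, y, hy, _, measurableSet_linked_radii y d.compact_W d.convex_W d.closed_A d.closed_B,
    fun ψ => ?_⟩
  ext ω
  simp only [LinkData.fieldEvent, hocc, Set.mem_ofPred_eq]

lemma LinkData.fieldEvent_comap (d : LinkData) (g : Plane ≃ᵃⁱ[ℝ] Plane)
    (s : Set (Plane × unitInterval)) :
    d.fieldEvent φ s =
      (d.comap g).fieldEvent (fun ω x => φ ω (g x)) (Prod.map g id ⁻¹' s) := by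
  ext ω
  simp only [LinkData.fieldEvent, Set.mem_ofPred_eq]
  rw [← linked_preimage_iff g, preimage_occupied]
  rfl

lemma finite_preimage_prodMap (g : Plane ≃ᵃⁱ[ℝ] Plane) {s : Set (Plane × unitInterval)}
    (hs : s.Finite) : (Prod.map g id ⁻¹' s).Finite :=
  hs.preimage (g.injective.prodMap Function.injective_id).injOn

/-- Finitely many values of the field on `S` are measurable with respect to `fieldSigma φ S`. -/
lemma measurableSet_fieldSigma {S : Set Plane} {k : ℕ} {y : Fin k → Plane} (hy : ∀ i, y i ∈ S)
    {C : Set (Fin k → ℝ≥0)} (hC : MeasurableSet C) :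
    MeasurableSet[fieldSigma φ S] {ω | (fun i => φ ω (y i)) ∈ C} := by
  have h : Measurable[fieldSigma φ S] fun ω i => φ ω (y i) := by
    refine @measurable_pi_lambda _ _ _ (fieldSigma φ S) _ _ fun i => ?_
    refine Measurable.of_comap_le ?_
    exact le_iSup₂_of_le (f := fun x (_ : x ∈ S) =>
      MeasurableSpace.comap (fun ω => φ ω x) inferInstance) (y i) (hy i) le_rfl
  exact h hC

end Events

lemma measurable_indicator_one {α : Type*} {m : MeasurableSpace α} {E : Set α}
    (hE : MeasurableSet E) : Measurable (E.indicator (1 : α → ℝ)) :=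
  measurable_one.indicator hE

section Probability

variable {Ω Ω' : Type*} [MeasurableSpace Ω] [MeasurableSpace Ω'] {μ : Measure Ω}
  {ν : Measure Ω'} {lam : ℝ≥0} {η : Ω → Set (Plane × unitInterval)} {φ : Ω' → Plane → ℝ≥0}

lemma LinkData.measurableSet_confEvent (d : LinkData) (hφ : Measurable (Function.uncurry φ)) :
    MeasurableSet (d.confEvent φ) :=
  measurableSet_linked (Z := FinConf × Ω') (ξ := fun z => z.1.points) (fun z => z.1.finite)
    (FinConf.countKernel.comap Prod.fst measurable_fst)
    (fun z _ hS => FinConf.countKernel_ne_zero z.1 hS) (pos := Prod.fst) measurable_fst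
    (ρ := fun z p => φ z.2 p.1)
    (hφ.comp (measurable_fst.snd.prodMk measurable_snd.fst))
    d.compact_W d.convex_W d.closed_A d.closed_B

lemma LinkData.measurableSet_event (d : LinkData) (hη : IsPoissonProcess μ lam η)
    (hφ : Measurable (Function.uncurry φ)) : MeasurableSet (d.event η φ) := by
  have hw := hη.measurable_window d.bounded_T d.measurable_T
  exact (hw.comp measurable_fst).prodMk measurable_snd (d.measurableSet_confEvent hφ)

lemma LinkData.measure_fieldEvent_comap (d : LinkData) {g : Plane ≃ᵃⁱ[ℝ] Plane}
    (hg : IsSymmetry ν φ g) {s : Set (Plane × unitInterval)} (hs : s.Finite) :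
    ν (d.fieldEvent φ s) = ν ((d.comap g).fieldEvent φ (Prod.map g id ⁻¹' s)) := by
  rw [d.fieldEvent_comap g]
  obtain ⟨k, y, -, C, hC, h⟩ :=
    (d.comap g).exists_fieldEvent_eq (Ω' := Ω') (finite_preimage_prodMap g hs)
  rw [h, h]
  exact (hg.identDistrib k y).measure_mem_eq hC

variable [IsProbabilityMeasure ν]

lemma LinkData.measure_event_eq_lintegral (d : LinkData) (hη : IsPoissonProcess μ lam η)
    (hφ : Measurable (Function.uncurry φ)) :
    (μ.prod ν) (d.event η φ) =
      ∫⁻ s, ν (d.fieldEvent φ s.points) ∂(μ.map (hη.window d.bounded_T)) := by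
  have hw := hη.measurable_window d.bounded_T d.measurable_T
  have hf : Measurable fun s : FinConf => ν (d.fieldEvent φ s.points) :=
    measurable_measure_prodMk_left (d.measurableSet_confEvent hφ)
  rw [lintegral_map hf hw, Measure.prod_apply (d.measurableSet_event hη hφ)]
  rfl

variable [IsProbabilityMeasure μ]

variable [IsProbabilityMeasure μ]

/-- The probability of a connection event does not change when the event is moved by a symmetry. -/
lemma LinkData.measure_event_comap (d : LinkData) (hη : IsPoissonProcess μ lam η)
    (hφ : Measurable (Function.uncurry φ)) {g : Plane ≃ᵃⁱ[ℝ] Plane} (hg : IsSymmetry ν φ g) :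
    (μ.prod ν) (d.event η φ) = (μ.prod ν) ((d.comap g).event η φ) := by
  have hη' := hη.preimage g.toHomeomorph hg.measurePreserving
  rw [(d.comap g).measure_event_eq_lintegral hη hφ,
    hη.map_window_eq hη' (d.comap g).bounded_T (d.comap g).measurable_T,
    ← (d.comap g).measure_event_eq_lintegral hη' hφ,
    Measure.prod_apply (d.measurableSet_event hη hφ),
    Measure.prod_apply ((d.comap g).measurableSet_event hη' hφ)]
  refine lintegral_congr fun ω => ?_
  rw [d.preimage_mk_event, (d.comap g).preimage_mk_event,
    d.measure_fieldEvent_comap hg (hη.finite_slab d.bounded_T ω)]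
  rfl

/-! ### Decoupling distant connection events -/

lemma fieldSigma_le (hφ : Measurable (Function.uncurry φ)) (S : Set Plane) :
    fieldSigma φ S ≤ (inferInstance : MeasurableSpace Ω') := by
  refine iSup₂_le fun x _ => ?_
  have : Measurable fun ω => φ ω x := hφ.comp (measurable_id.prodMk measurable_const)
  exact this.comap_le

lemma measureReal_inter_le_add_piBar (hφ : Measurable (Function.uncurry φ)) {ε₀ : ℝ} {n : ℕ}
    {E₁ E₂ : Set Ω'}
    (h₁ : MeasurableSet[fieldSigma φ (square 0 ((1 + ε₀ / 4) * n))] E₁)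
    (h₂ : MeasurableSet[fieldSigma φ (square !₂[(2 + ε₀) * n, 0] ((1 + ε₀ / 4) * n))] E₂) :
    ν.real (E₁ ∩ E₂) ≤ ν.real E₁ * ν.real E₂ + piBar ν φ ε₀ n := by
  have m₁ := fieldSigma_le hφ _ _ h₁
  have m₂ := fieldSigma_le hφ _ _ h₂
  have key : |ν.real (E₁ ∩ E₂) - ν.real E₁ * ν.real E₂| ≤ piBar ν φ ε₀ n := by
    refine le_csSup ⟨1, ?_⟩ ⟨E₁.indicator 1, E₂.indicator 1, ?_, ?_, ?_, ?_, ?_⟩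
    · rintro c ⟨g₁, g₂, hg₁, hg₂, -, -, rfl⟩
      have b : ∀ f : Ω' → ℝ, (∀ ω, f ω ∈ Set.Icc (0 : ℝ) 1) →
          (∫ ω, f ω ∂ν) ∈ Set.Icc (0 : ℝ) 1 := by
        intro f hf
        refine ⟨integral_nonneg fun ω => (hf ω).1, ?_⟩
        by_cases hi : Integrable f ν
        · simpa using integral_mono hi (integrable_const (1 : ℝ)) fun ω => (hf ω).2
        · rw [integral_undef hi]
          exact zero_le_one
      have b₁ := b g₁ hg₁
      have b₂ := b g₂ hg₂
      have b₃ := b (fun ω => g₁ ω * g₂ ω) fun ω =>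
        ⟨mul_nonneg (hg₁ ω).1 (hg₂ ω).1, mul_le_one₀ (hg₁ ω).2 (hg₂ ω).1 (hg₂ ω).2⟩
      have b₄ : 0 ≤ (∫ ω, g₁ ω ∂ν) * ∫ ω, g₂ ω ∂ν := mul_nonneg b₁.1 b₂.1
      have b₅ : (∫ ω, g₁ ω ∂ν) * (∫ ω, g₂ ω ∂ν) ≤ 1 := mul_le_one₀ b₁.2 b₂.1 b₂.2
      rw [abs_le]
      constructor <;> linarith [b₃.1, b₃.2]
    · intro ω
      by_cases h : ω ∈ E₁ <;> simp [h]
    · intro ω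
      by_cases h : ω ∈ E₂ <;> simp [h]
    · exact measurable_indicator_one h₁
    · exact measurable_indicator_one h₂
    · have : (fun ω => E₁.indicator (1 : Ω' → ℝ) ω * E₂.indicator (1 : Ω' → ℝ) ω) =
          (E₁ ∩ E₂).indicator 1 := by
        rw [Set.inter_indicator_one]
        rfl
      rw [this, integral_indicator_one m₁, integral_indicator_one m₂,
        integral_indicator_one (m₁.inter m₂)]
  linarith [le_abs_self (ν.real (E₁ ∩ E₂) - ν.real E₁ * ν.real E₂)]

/-- Decoupling for fixed centres in two squares that a symmetry maps to the position required in
the definition of `piBar`. -/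
lemma LinkData.measureReal_fieldEvent_inter_le (d₁ d₂ : LinkData)
    (hφ : Measurable (Function.uncurry φ)) {ε₀ : ℝ} {n : ℕ} {g : Plane ≃ᵃⁱ[ℝ] Plane}
    (hg : IsSymmetry ν φ g) {s₁ s₂ : Set (Plane × unitInterval)} (hs₁ : s₁.Finite)
    (hs₂ : s₂.Finite) (h₁ : ∀ p ∈ s₁, p.1 ∈ g '' square 0 ((1 + ε₀ / 4) * n))
    (h₂ : ∀ p ∈ s₂, p.1 ∈ g '' square !₂[(2 + ε₀) * n, 0] ((1 + ε₀ / 4) * n)) :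
    ν.real ((d₁.fieldEvent φ s₁)ᶜ ∩ (d₂.fieldEvent φ s₂)ᶜ) ≤
      ν.real (d₁.fieldEvent φ s₁)ᶜ * ν.real (d₂.fieldEvent φ s₂)ᶜ + piBar ν φ ε₀ n := by
  obtain ⟨k, y, hy, C, hC, hE⟩ :=
    (d₁.comap g).exists_fieldEvent_eq (Ω' := Ω') (finite_preimage_prodMap g hs₁)
  obtain ⟨l, z, hz, D, hD, hF⟩ :=
    (d₂.comap g).exists_fieldEvent_eq (Ω' := Ω') (finite_preimage_prodMap g hs₂)
  have hy' : ∀ i, y i ∈ square 0 ((1 + ε₀ / 4) * n) := by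
    intro i
    obtain ⟨p, hp, hpi⟩ := hy i
    obtain ⟨u, hu, hup⟩ := h₁ _ hp
    have : u = p.1 := g.injective hup
    rwa [← hpi, ← this]
  have hz' : ∀ i, z i ∈ square !₂[(2 + ε₀) * n, 0] ((1 + ε₀ / 4) * n) := by
    intro i
    obtain ⟨p, hp, hpi⟩ := hz i
    obtain ⟨u, hu, hup⟩ := h₂ _ hp
    have : u = p.1 := g.injective hup
    rwa [← hpi, ← this]
  have hpi := measureReal_inter_le_add_piBar (ν := ν) hφ
    (measurableSet_fieldSigma hy' hC.compl) (measurableSet_fieldSigma hz' hD.compl)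
  rw [d₁.fieldEvent_comap g, d₂.fieldEvent_comap g, hE, hF]
  -- The joint law of the two families of radii is invariant under `g`.
  have hid := hg.identDistrib (k + l) (Fin.append y z)
  have e₁ : ν.real {ω | (fun i => φ ω (y i)) ∈ Cᶜ} =
      ν.real {ω | (fun i => φ ω (g (y i))) ∈ C}ᶜ := by
    rw [measureReal_def, measureReal_def]
    exact congrArg _ ((hg.identDistrib k y).measure_mem_eq hC.compl).symm
  have e₂ : ν.real {ω | (fun i => φ ω (z i)) ∈ Dᶜ} =
      ν.real {ω | (fun i => φ ω (g (z i))) ∈ D}ᶜ := by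
    rw [measureReal_def, measureReal_def]
    exact congrArg _ ((hg.identDistrib l z).measure_mem_eq hD.compl).symm
  have e₃ : ν.real ({ω | (fun i => φ ω (y i)) ∈ Cᶜ} ∩ {ω | (fun i => φ ω (z i)) ∈ Dᶜ}) =
      ν.real ({ω | (fun i => φ ω (g (y i))) ∈ C}ᶜ ∩ {ω | (fun i => φ ω (g (z i))) ∈ D}ᶜ) := by
    have hS : MeasurableSet {r : Fin (k + l) → ℝ≥0 | (fun i => r (Fin.castAdd l i)) ∈ Cᶜ ∧
        (fun i => r (Fin.natAdd k i)) ∈ Dᶜ} := by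
      refine MeasurableSet.inter (hC.compl.preimage ?_) (hD.compl.preimage ?_) <;> fun_prop
    have h := hid.measure_mem_eq hS
    rw [measureReal_def, measureReal_def]
    refine congrArg _ ?_
    convert! h.symm using 2 <;>
    · ext ω
      simp [Fin.append_left, Fin.append_right]
  rw [← e₁, ← e₂, ← e₃]
  exact hpi

/-- Decoupling of two connection events whose ranges lie in disjoint squares, as in the definition
of `piBar` up to a symmetry: the points are independent, and the correlation of the field is at
most `piBar`. -/
lemma LinkData.measureReal_compl_inter_le (d₁ d₂ : LinkData) (hη : IsPoissonProcess μ lam η)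
    (hφ : Measurable (Function.uncurry φ)) {ε₀ : ℝ} {n : ℕ} {g : Plane ≃ᵃⁱ[ℝ] Plane}
    (hg : IsSymmetry ν φ g) (h₁ : d₁.T ⊆ g '' square 0 ((1 + ε₀ / 4) * n))
    (h₂ : d₂.T ⊆ g '' square !₂[(2 + ε₀) * n, 0] ((1 + ε₀ / 4) * n))
    (hd : Disjoint d₁.T d₂.T) :
    (μ.prod ν).real ((d₁.event η φ)ᶜ ∩ (d₂.event η φ)ᶜ) ≤
      (μ.prod ν).real (d₁.event η φ)ᶜ * (μ.prod ν).real (d₂.event η φ)ᶜ + piBar ν φ ε₀ n := by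
  have hw₁ := hη.measurable_window d₁.bounded_T d₁.measurable_T
  have hw₂ := hη.measurable_window d₂.bounded_T d₂.measurable_T
  have hE₁ := (d₁.measurableSet_event hη hφ).compl
  have hE₂ := (d₂.measurableSet_event hη hφ).compl
  have hfub : ∀ E : Set (Ω × Ω'), MeasurableSet E →
      (μ.prod ν).real E = ∫ ω, ν.real (Prod.mk ω ⁻¹' E) ∂μ := by
    intro E hE
    simp only [measureReal_def]
    rw [Measure.prod_apply hE, integral_toReal (measurable_measure_prodMk_left hE).aemeasurable
      (Eventually.of_forall fun ω => measure_lt_top _ _)]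
  have hint : ∀ E : Set (Ω × Ω'), MeasurableSet E →
      Integrable (fun ω => ν.real (Prod.mk ω ⁻¹' E)) μ := by
    intro E hE
    refine Integrable.of_bound (C := 1)
      (measurable_measure_prodMk_left hE).ennreal_toReal.aestronglyMeasurable
      (Eventually.of_forall fun ω => ?_)
    rw [Real.norm_of_nonneg measureReal_nonneg]
    exact measureReal_le_one
  have hψ : ∀ d : LinkData, Measurable fun s : FinConf => ν.real (d.fieldEvent φ s.points)ᶜ :=
    fun d => (measurable_measure_prodMk_left (d.measurableSet_confEvent hφ).compl).ennreal_toReal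
  obtain ⟨f₁, hf₁⟩ : ∃ f : Ω → ℝ, f = fun ω => ν.real (Prod.mk ω ⁻¹' (d₁.event η φ)ᶜ) := ⟨_, rfl⟩
  obtain ⟨f₂, hf₂⟩ : ∃ f : Ω → ℝ, f = fun ω => ν.real (Prod.mk ω ⁻¹' (d₂.event η φ)ᶜ) := ⟨_, rfl⟩
  have hind : IndepFun f₁ f₂ μ := by
    rw [hf₁, hf₂]
    exact (hη.indepFun_window d₁.bounded_T d₁.measurable_T d₂.bounded_T d₂.measurable_T
      hd).comp (hψ d₁) (hψ d₂)
  have i₁ : Integrable f₁ μ := hf₁ ▸ hint _ hE₁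
  have i₂ : Integrable f₂ μ := hf₂ ▸ hint _ hE₂
  have hle : ∀ ω, ν.real (Prod.mk ω ⁻¹' ((d₁.event η φ)ᶜ ∩ (d₂.event η φ)ᶜ)) ≤
      f₁ ω * f₂ ω + piBar ν φ ε₀ n := by
    intro ω
    simp only [hf₁, hf₂, Set.preimage_inter, Set.preimage_compl, LinkData.preimage_mk_event]
    exact d₁.measureReal_fieldEvent_inter_le d₂ hφ hg (hη.finite_slab d₁.bounded_T ω)
      (hη.finite_slab d₂.bounded_T ω) (fun p hp => h₁ hp.2) (fun p hp => h₂ hp.2)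
  have i₁₂ : Integrable (fun ω => f₁ ω * f₂ ω) μ := hind.integrable_mul i₁ i₂
  rw [hfub _ (hE₁.inter hE₂), hfub _ hE₁, hfub _ hE₂, ← hf₁, ← hf₂]
  refine (integral_mono (hint _ (hE₁.inter hE₂)) (i₁₂.add (integrable_const _)) hle).trans ?_
  simp only [Pi.add_apply]
  rw [integral_add i₁₂ (integrable_const _),
    hind.integral_fun_mul_eq_mul_integral i₁.aestronglyMeasurable i₂.aestronglyMeasurable]
  simp

end Probability

/-! ### Translations and rotations -/

/-- Rotation by a right angle, as a linear isometry. -/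
noncomputable def rotIsometry : Plane ≃ₗᵢ[ℝ] Plane where
  toFun := rot
  invFun x := !₂[x 1, -x 0]
  map_add' x y := by
    ext i
    fin_cases i
    · simp [rot]; ring
    · simp [rot]
  map_smul' c x := by
    ext i
    fin_cases i <;> simp [rot]
  left_inv x := by
    ext i
    fin_cases i <;> simp [rot]
  right_inv x := by
    ext i
    fin_cases i <;> simp [rot]
  norm_map' x := by
    simp [EuclideanSpace.norm_eq, rot, add_comm]

/-- The rotation by a right angle followed by the translation by `v`. -/
noncomputable def rotTrans (v : Plane) : Plane ≃ᵃⁱ[ℝ] Plane :=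
  rotIsometry.toAffineIsometryEquiv.trans (AffineIsometryEquiv.constVAdd ℝ Plane v)

lemma rotTrans_apply (v x : Plane) : rotTrans v x = v + rot x := rfl

lemma constVAdd_apply (v x : Plane) : AffineIsometryEquiv.constVAdd ℝ Plane v x = v + x := rfl

section Symmetry

variable {Ω' : Type*} [MeasurableSpace Ω'] {ν : Measure Ω'} {φ : Ω' → Plane → ℝ≥0}

lemma isSymmetry_constVAdd (hstat : IsStationary ν φ) (v : Plane) :
    IsSymmetry ν φ (AffineIsometryEquiv.constVAdd ℝ Plane v) where
  measurePreserving := measurePreserving_add_left volume v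
  identDistrib k y := by simpa only [constVAdd_apply, add_comm v] using hstat v k y

lemma isSymmetry_rotTrans (hstat : IsStationary ν φ) (hrot : IsRotationInvariant ν φ) (v : Plane) :
    IsSymmetry ν φ (rotTrans v) where
  measurePreserving :=
    (measurePreserving_add_left volume v).comp rotIsometry.measurePreserving
  identDistrib k y := by
    have h := (hstat v k fun i => rot (y i)).trans (hrot k y)
    simpa only [rotTrans_apply, add_comm v] using h

end Symmetry

/-! ### Crossing events -/

lemma isCompact_box (a b c d : ℝ) : IsCompact (box a b c d) := by
  have h := (EuclideanSpace.equiv (Fin 2) ℝ).toHomeomorph.isCompact_preimage.2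
    (isCompact_univ_pi fun i : Fin 2 => isCompact_Icc (a := ![a, c] i) (b := ![b, d] i))
  convert! h using 1
  ext u
  simp only [box, Set.mem_ofPred_eq, Set.mem_preimage, Set.mem_pi, Set.mem_univ, forall_const,
    Fin.forall_fin_two, Set.mem_Icc]
  rfl

lemma convex_box (a b c d : ℝ) : Convex ℝ (box a b c d) := by
  have h := (convex_pi fun i (_ : i ∈ Set.univ) => convex_Icc (![a, c] i) (![b, d] i)).linear_preimage
    (EuclideanSpace.equiv (Fin 2) ℝ).toLinearEquiv.toLinearMap
  convert! h using 1
  ext u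
  simp only [box, Set.mem_ofPred_eq, Set.mem_preimage, Set.mem_pi, Set.mem_univ, forall_const,
    Fin.forall_fin_two, Set.mem_Icc]
  rfl

lemma mem_square {c u : Plane} {r : ℝ} :
    u ∈ square c r ↔ |u 0 - c 0| ≤ r ∧ |u 1 - c 1| ≤ r := by
  simp [square, Fin.forall_fin_two]

lemma square_eq_box (c : Plane) (r : ℝ) :
    square c r = box (c 0 - r) (c 0 + r) (c 1 - r) (c 1 + r) := by
  ext u
  simp only [mem_square, box, abs_le, Set.mem_ofPred_eq]
  constructor
  · rintro ⟨⟨_, _⟩, _, _⟩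
    refine ⟨⟨?_, ?_⟩, ?_, ?_⟩ <;> linarith
  · rintro ⟨⟨_, _⟩, _, _⟩
    refine ⟨⟨?_, ?_⟩, ?_, ?_⟩ <;> linarith

lemma isCompact_square (c : Plane) (r : ℝ) : IsCompact (square c r) :=
  square_eq_box c r ▸ isCompact_box _ _ _ _

lemma convex_square (c : Plane) (r : ℝ) : Convex ℝ (square c r) :=
  square_eq_box c r ▸ convex_box _ _ _ _

lemma isClosed_axisLine (i : Fin 2) (a : ℝ) : IsClosed (axisLine i a) :=
  isClosed_eq (by fun_prop) continuous_const

lemma LinkData.ext {d e : LinkData} (hW : d.W = e.W) (hA : d.A = e.A) (hB : d.B = e.B)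
    (hT : d.T = e.T) : d = e := by
  cases d
  cases e
  simp_all

/-- The horizontal crossing of the rectangle `[x, x + 3s] × [y, y + s]`, by the discs with centres
in the square around its lower left corner that has radius `4s`, enlarged as in the definition
of `piLam`. -/
def hCross (ε₀ x y s : ℝ) : LinkData where
  W := box x (x + 3 * s) y (y + s)
  A := axisLine 0 x
  B := axisLine 0 (x + 3 * s)
  T := square !₂[x, y] ((1 + ε₀ / 4) * (4 * s))
  compact_W := isCompact_box _ _ _ _
  convex_W := convex_box _ _ _ _
  closed_A := isClosed_axisLine _ _
  closed_B := isClosed_axisLine _ _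
  bounded_T := (isCompact_square _ _).isBounded
  measurable_T := (isCompact_square _ _).measurableSet

/-- The vertical crossing of the rectangle `[x, x + s] × [y, y + 3s]`: the event `hCross`, rotated
by a right angle. -/
def vCross (ε₀ x y s : ℝ) : LinkData where
  W := box x (x + s) y (y + 3 * s)
  A := axisLine 1 y
  B := axisLine 1 (y + 3 * s)
  T := square !₂[x + s, y] ((1 + ε₀ / 4) * (4 * s))
  compact_W := isCompact_box _ _ _ _
  convex_W := convex_box _ _ _ _
  closed_A := isClosed_axisLine _ _
  closed_B := isClosed_axisLine _ _
  bounded_T := (isCompact_square _ _).isBounded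
  measurable_T := (isCompact_square _ _).measurableSet

lemma hCross_comap (ε₀ x y s : ℝ) :
    (hCross ε₀ x y s).comap (AffineIsometryEquiv.constVAdd ℝ Plane !₂[x, y]) =
      hCross ε₀ 0 0 s := by
  refine LinkData.ext ?_ ?_ ?_ ?_ <;> ext u
  · simp [LinkData.comap, hCross, box]
  · simp [LinkData.comap, hCross, axisLine]
  · simp [LinkData.comap, hCross, axisLine]
  · simp [LinkData.comap, hCross, mem_square]

lemma vCross_comap (ε₀ x y s : ℝ) :
    (vCross ε₀ x y s).comap (rotTrans !₂[x + s, y]) = hCross ε₀ 0 0 s := by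
  refine LinkData.ext ?_ ?_ ?_ ?_ <;> ext u
  · simp only [LinkData.comap, hCross, vCross, box, rotTrans_apply, rot, Set.mem_preimage,
      Set.mem_ofPred_eq, PiLp.add_apply, Matrix.cons_val_zero, Matrix.cons_val_one]
    constructor
    · rintro ⟨⟨_, _⟩, _, _⟩
      refine ⟨⟨?_, ?_⟩, ?_, ?_⟩ <;> linarith
    · rintro ⟨⟨_, _⟩, _, _⟩
      refine ⟨⟨?_, ?_⟩, ?_, ?_⟩ <;> linarith
  · simp [LinkData.comap, hCross, vCross, axisLine, rotTrans_apply, rot]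
  · simp [LinkData.comap, hCross, vCross, axisLine, rotTrans_apply, rot]
  · simp [LinkData.comap, hCross, vCross, mem_square, rotTrans_apply, rot, and_comm]

/-- Horizontal crossings of overlapping rectangles along a strip, glued by vertical crossings, form a
crossing of the strip. -/
lemma linked_strip {O : Set Plane} {s y y' : ℝ} (hs : 0 ≤ s) (hy : y' ≤ y)
    (hy' : y + s ≤ y' + 3 * s) (N : ℕ)
    (hH : ∀ i ≤ N, Linked (box (i * s) (i * s + 3 * s) y (y + s)) (axisLine 0 (i * s))
      (axisLine 0 (i * s + 3 * s)) O)
    (hV : ∀ i ≤ N, Linked (box (i * s) (i * s + s) y' (y' + 3 * s)) (axisLine 1 y')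
      (axisLine 1 (y' + 3 * s)) O) :
    Linked (box 0 (N * s + 3 * s) y' (y' + 3 * s)) (axisLine 0 0) (axisLine 0 (N * s + 3 * s)) O := by
  choose! a ha b hb hab using hH
  choose! c hc d hd hcd using hV
  set S := O ∩ box 0 (N * s + 3 * s) y' (y' + 3 * s) with hS
  have hi : ∀ i : ℕ, i ≤ N → (i : ℝ) * s ≤ N * s := fun i h =>
    mul_le_mul_of_nonneg_right (by exact_mod_cast h) hs
  have hSH : ∀ i ≤ N, O ∩ box (i * s) (i * s + 3 * s) y (y + s) ⊆ S := by
    rintro i hiN u ⟨hu, ⟨_, _⟩, _, _⟩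
    have := hi i hiN
    have : 0 ≤ (i : ℝ) * s := by positivity
    refine ⟨hu, ⟨?_, ?_⟩, ?_, ?_⟩ <;> linarith
  have hSV : ∀ i ≤ N, O ∩ box (i * s) (i * s + s) y' (y' + 3 * s) ⊆ S := by
    rintro i hiN u ⟨hu, ⟨_, _⟩, _, _⟩
    have := hi i hiN
    have : 0 ≤ (i : ℝ) * s := by positivity
    refine ⟨hu, ⟨?_, ?_⟩, ?_, ?_⟩ <;> linarith
  have cross : ∀ i ≤ N, ∀ j ≤ N, i ≤ j → j ≤ i + 1 → JoinedIn S (a i) (c j) := by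
    intro i hiN j hjN hij hji
    have h1 : (i : ℝ) * s ≤ j * s := mul_le_mul_of_nonneg_right (by exact_mod_cast hij) hs
    have h2 : (j : ℝ) * s ≤ i * s + s := by
      have := mul_le_mul_of_nonneg_right (show (j : ℝ) ≤ i + 1 by exact_mod_cast hji) hs
      linarith
    have hai : a i 0 = i * s := ha i hiN
    have hbi : b i 0 = i * s + 3 * s := hb i hiN
    have hci : c j 1 = y' := hc j hjN
    have hdi : d j 1 = y' + 3 * s := hd j hjN
    exact joinedIn_of_cross (hab i hiN) (hcd j hjN) (hSH i hiN) (hSV j hjN)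
      (a := j * s) (b := j * s + s) (c := y) (d := y + s) (by linarith) (by linarith)
      (fun u hu => hu.2.2) (by linarith) (by linarith) (fun u hu => hu.2.1)
  have step : ∀ i ≤ N, JoinedIn S (a 0) (a i) := by
    intro i
    induction i with
    | zero => exact fun h => ((hab 0 h).mono (hSH 0 h)).trans ((hab 0 h).mono (hSH 0 h)).symm
    | succ i ih =>
      intro h
      exact (ih (by omega)).trans ((cross i (by omega) (i + 1) h (by omega) le_rfl).trans
        (cross (i + 1) h (i + 1) h le_rfl (by omega)).symm)
  refine ⟨a 0, ?_, b N, hb N le_rfl, (step N le_rfl).trans ((hab N le_rfl).mono (hSH N le_rfl))⟩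
  simpa using ha 0 (Nat.zero_le _)

lemma occupiedFrom_mono {K K' : Set Plane} (h : K ⊆ K') (s : Set (Plane × unitInterval))
    (f : Plane → ℝ≥0) : occupiedFrom K s f ⊆ occupiedFrom K' s f :=
  Set.biUnion_subset_biUnion_left fun _ hp => ⟨hp.1, h hp.2⟩

lemma occupiedFrom_subset (K : Set Plane) (s : Set (Plane × unitInterval)) (f : Plane → ℝ≥0) :
    occupiedFrom K s f ⊆ occupied s f :=
  Set.biUnion_subset_biUnion_left fun _ hp => hp.1

/-- The `i`-th horizontal or vertical piece of a crossing of the strip at height `y`; the vertical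
pieces start at height `y'`. The pieces with `i ≤ 78` cover the width `3 * 27 * s`. -/
def stripPiece (ε₀ y y' s : ℝ) (p : Fin 79 × Bool) : LinkData :=
  if p.2 then hCross ε₀ ((p.1 : ℕ) * s) y s else vCross ε₀ ((p.1 : ℕ) * s) y' s

lemma mem_event_hCross_of_strip {Ω Ω' : Type*} {η : Ω → Set (Plane × unitInterval)}
    {φ : Ω' → Plane → ℝ≥0} {ε₀ y y' s : ℝ} (hε : 0 ≤ ε₀) (hε' : ε₀ ≤ 1 / 5) (hs : 0 ≤ s)
    (h0 : 0 ≤ y') (hy : y' ≤ y) (hy' : y + s ≤ y' + 3 * s) (hy1 : y' + 3 * s ≤ 27 * s)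
    {w : Ω × Ω'} (h : ∀ p, w ∈ (stripPiece ε₀ y y' s p).event η φ) :
    w ∈ (hCross ε₀ 0 0 (27 * s)).event η φ := by
  have hεs : 0 ≤ ε₀ * s := by positivity
  have hεs' : ε₀ * s ≤ 1 / 5 * s := mul_le_mul_of_nonneg_right hε' hs
  have hi : ∀ i : ℕ, i ≤ 78 → 0 ≤ (i : ℝ) * s ∧ (i : ℝ) * s ≤ 78 * s := fun i h =>
    ⟨by positivity, mul_le_mul_of_nonneg_right (by exact_mod_cast h) hs⟩
  have hsub : ∀ c0 c1 : ℝ, 0 ≤ c0 → c0 ≤ 79 * s → 0 ≤ c1 → c1 ≤ 27 * s →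
      square !₂[c0, c1] ((1 + ε₀ / 4) * (4 * s)) ⊆
        square !₂[0, 0] ((1 + ε₀ / 4) * (4 * (27 * s))) := by
    intro c0 c1 h1 h2 h3 h4 u hu
    simp only [mem_square, abs_le, Matrix.cons_val_zero, Matrix.cons_val_one] at hu ⊢
    obtain ⟨⟨_, _⟩, _, _⟩ := hu
    refine ⟨⟨?_, ?_⟩, ?_, ?_⟩ <;> linarith
  set O := occupiedFrom (square !₂[0, 0] ((1 + ε₀ / 4) * (4 * (27 * s)))) (η w.1) (φ w.2) with hO
  have hstrip := linked_strip (O := O) hs hy hy' 78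
    (fun i hiN => by
      have h1 := h (⟨i, by omega⟩, true)
      simp only [stripPiece, if_true] at h1
      refine h1.mono le_rfl le_rfl le_rfl (occupiedFrom_mono (hsub _ _ ?_ ?_ ?_ ?_) _ _) <;>
      linarith [(hi i hiN).1, (hi i hiN).2])
    (fun i hiN => by
      have h1 := h (⟨i, by omega⟩, false)
      simp only [stripPiece, Bool.false_eq_true, if_false] at h1
      refine h1.mono le_rfl le_rfl le_rfl (occupiedFrom_mono (hsub _ _ ?_ ?_ ?_ ?_) _ _) <;>
      linarith [(hi i hiN).1, (hi i hiN).2])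
  have e : ((78 : ℕ) : ℝ) * s + 3 * s = 0 + 3 * (27 * s) := by push_cast; ring
  rw [e] at hstrip
  refine hstrip.mono ?_ le_rfl le_rfl le_rfl
  rintro u ⟨hu, _, _⟩
  refine ⟨hu, ?_, ?_⟩ <;> linarith

section Bootstrap

variable {Ω Ω' : Type*} [MeasurableSpace Ω] [MeasurableSpace Ω'] {μ : Measure Ω}
  [IsProbabilityMeasure μ] {ν : Measure Ω'} [IsProbabilityMeasure ν] {lam : ℝ≥0}
  {η : Ω → Set (Plane × unitInterval)} {φ : Ω' → Plane → ℝ≥0}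

lemma measureReal_hCross_compl (hη : IsPoissonProcess μ lam η)
    (hφ : Measurable (Function.uncurry φ)) (hstat : IsStationary ν φ) (ε₀ x y s : ℝ) :
    (μ.prod ν).real ((hCross ε₀ x y s).event η φ)ᶜ =
      (μ.prod ν).real ((hCross ε₀ 0 0 s).event η φ)ᶜ := by
  rw [probReal_compl_eq_one_sub (LinkData.measurableSet_event _ hη hφ),
    probReal_compl_eq_one_sub (LinkData.measurableSet_event _ hη hφ), measureReal_def,
    measureReal_def, LinkData.measure_event_comap _ hη hφ (isSymmetry_constVAdd hstat !₂[x, y]),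
    hCross_comap]

lemma measureReal_vCross_compl (hη : IsPoissonProcess μ lam η)
    (hφ : Measurable (Function.uncurry φ)) (hstat : IsStationary ν φ)
    (hrot : IsRotationInvariant ν φ) (ε₀ x y s : ℝ) :
    (μ.prod ν).real ((vCross ε₀ x y s).event η φ)ᶜ =
      (μ.prod ν).real ((hCross ε₀ 0 0 s).event η φ)ᶜ := by
  rw [probReal_compl_eq_one_sub (LinkData.measurableSet_event _ hη hφ),
    probReal_compl_eq_one_sub (LinkData.measurableSet_event _ hη hφ), measureReal_def,
    measureReal_def,
    LinkData.measure_event_comap _ hη hφ (isSymmetry_rotTrans hstat hrot !₂[x + s, y]),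
    vCross_comap]

lemma measureReal_stripPiece_compl (hη : IsPoissonProcess μ lam η)
    (hφ : Measurable (Function.uncurry φ)) (hstat : IsStationary ν φ)
    (hrot : IsRotationInvariant ν φ) (ε₀ y y' s : ℝ) (p : Fin 79 × Bool) :
    (μ.prod ν).real ((stripPiece ε₀ y y' s p).event η φ)ᶜ =
      (μ.prod ν).real ((hCross ε₀ 0 0 s).event η φ)ᶜ := by
  rw [stripPiece]
  split_ifs
  · exact measureReal_hCross_compl hη hφ hstat _ _ _ _
  · exact measureReal_vCross_compl hη hφ hstat hrot _ _ _ _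

lemma stripPiece_T_subset {ε₀ y y' s : ℝ} (hε' : ε₀ ≤ 1 / 5) (hs : 0 ≤ s)
    (p : Fin 79 × Bool) : (stripPiece ε₀ y y' s p).T ⊆
      box (-(5 * s)) (84 * s) (min y y' - 21 / 5 * s) (max y y' + 21 / 5 * s) := by
  have hεs' : ε₀ * s ≤ 1 / 5 * s := mul_le_mul_of_nonneg_right hε' hs
  have hi : 0 ≤ ((p.1 : ℕ) : ℝ) * s ∧ ((p.1 : ℕ) : ℝ) * s ≤ 78 * s :=
    ⟨by positivity, mul_le_mul_of_nonneg_right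
      (by exact_mod_cast Nat.le_of_lt_succ p.1.2) hs⟩
  have h1 := min_le_left y y'
  have h2 := min_le_right y y'
  have h3 := le_max_left y y'
  have h4 := le_max_right y y'
  intro u hu
  rw [stripPiece] at hu
  split_ifs at hu <;>
  · simp only [hCross, vCross, mem_square, abs_le, Matrix.cons_val_zero, Matrix.cons_val_one] at hu
    obtain ⟨⟨_, _⟩, _, _⟩ := hu
    refine ⟨⟨?_, ?_⟩, ?_, ?_⟩ <;> linarith

lemma square_subset_rotTrans_image (v : Plane) (a r : ℝ) :
    square !₂[v 0, v 1 + a] r ⊆ rotTrans v '' square !₂[a, 0] r := by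
  intro u hu
  simp only [mem_square, Matrix.cons_val_zero, Matrix.cons_val_one] at hu
  refine ⟨!₂[u 1 - v 1, v 0 - u 0], ?_, ?_⟩
  · simp only [mem_square, Matrix.cons_val_zero, Matrix.cons_val_one]
    refine ⟨by rw [sub_sub]; exact hu.2, ?_⟩
    rw [sub_zero, abs_sub_comm]
    exact hu.1
  · ext i
    fin_cases i <;> simp [rotTrans_apply, rot]

/-- The bootstrap inequality: a rectangle at scale `27 n` is not crossed only if both a strip at its
bottom and a strip at its top contain an uncrossed rectangle at scale `n`, and these two
rectangles are far apart. -/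
lemma measureReal_hCross_compl_le (hη : IsPoissonProcess μ lam η)
    (hφ : Measurable (Function.uncurry φ)) (hstat : IsStationary ν φ)
    (hrot : IsRotationInvariant ν φ) {ε₀ : ℝ} (hε : 0 < ε₀) (hε' : ε₀ ≤ 1 / 5) {n : ℕ}
    (hn : 0 < n) :
    (μ.prod ν).real ((hCross ε₀ 0 0 (27 * n)).event η φ)ᶜ ≤
      158 ^ 2 * ((μ.prod ν).real ((hCross ε₀ 0 0 n).event η φ)ᶜ ^ 2
        + piBar ν φ ε₀ (50 * n)) := by
  have hs : (0 : ℝ) < n := by exact_mod_cast hn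
  set s : ℝ := (n : ℝ)
  set L := stripPiece ε₀ 0 0 s with hL
  set U := stripPiece ε₀ (26 * s) (24 * s) s with hU
  -- The two squares of radius `50 n` in the definition of `piBar` are turned upright and moved so
  -- that the top side of the lower one is at height `5 n`. The bottom side of the upper one is then
  -- at height `(5 + 50 ε₀) n ≤ 15 n`, while the ranges of the pieces of the lower and the upper strip
  -- lie below `21 n / 5` and above `(24 - 21 / 5) n`.
  set v : Plane := !₂[40 * s, -(45 * s)] with hv
  have hεs : 0 ≤ ε₀ * s := by positivity
  have hεs' : ε₀ * s ≤ 1 / 5 * s := mul_le_mul_of_nonneg_right hε' hs.le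
  have hsub : ((hCross ε₀ 0 0 (27 * s)).event η φ)ᶜ ⊆
      ⋃ p, ⋃ q, ((L p).event η φ)ᶜ ∩ ((U q).event η φ)ᶜ := by
    intro w hw
    have h1 : ∃ p, w ∉ (L p).event η φ := by
      by_contra! h
      exact hw (mem_event_hCross_of_strip hε.le hε' hs.le le_rfl le_rfl (by linarith)
        (by linarith) h)
    have h2 : ∃ p, w ∉ (U p).event η φ := by
      by_contra! h
      exact hw (mem_event_hCross_of_strip hε.le hε' hs.le (by linarith) (by linarith)
        (by linarith) (by linarith) h)
    obtain ⟨p, hp⟩ := h1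
    obtain ⟨q, hq⟩ := h2
    exact Set.mem_iUnion_of_mem p (Set.mem_iUnion_of_mem q ⟨hp, hq⟩)
  have hpair : ∀ p q, (μ.prod ν).real (((L p).event η φ)ᶜ ∩ ((U q).event η φ)ᶜ) ≤
      (μ.prod ν).real ((hCross ε₀ 0 0 s).event η φ)ᶜ ^ 2 + piBar ν φ ε₀ (50 * n) := by
    intro p q
    have hLT := stripPiece_T_subset (y := 0) (y' := 0) hε' hs.le p
    have hUT := stripPiece_T_subset (y := 26 * s) (y' := 24 * s) hε' hs.le q
    rw [min_self, max_self] at hLT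
    rw [min_eq_right (by linarith), max_eq_left (by linarith)] at hUT
    have h := (L p).measureReal_compl_inter_le (U q) hη hφ (ε₀ := ε₀) (n := 50 * n)
      (isSymmetry_rotTrans hstat hrot v) ?_ ?_ ?_
    · rw [hL, hU, measureReal_stripPiece_compl hη hφ hstat hrot,
        measureReal_stripPiece_compl hη hφ hstat hrot] at h
      rwa [sq]
    · have h0 : (0 : Plane) = !₂[0, 0] := by
        ext i
        fin_cases i <;> rfl
      rw [h0]
      refine Set.Subset.trans (fun u hu => ?_) (square_subset_rotTrans_image v _ _)
      obtain ⟨⟨_, _⟩, _, _⟩ := hLT hu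
      simp only [hv, mem_square, abs_le, Matrix.cons_val_zero, Matrix.cons_val_one]
      push_cast
      refine ⟨⟨?_, ?_⟩, ?_, ?_⟩ <;> linarith
    · refine Set.Subset.trans (fun u hu => ?_) (square_subset_rotTrans_image v _ _)
      obtain ⟨⟨_, _⟩, _, _⟩ := hUT hu
      simp only [hv, mem_square, abs_le, Matrix.cons_val_zero, Matrix.cons_val_one]
      push_cast
      refine ⟨⟨?_, ?_⟩, ?_, ?_⟩ <;> linarith
    · rw [Set.disjoint_left]
      intro u h1 h2
      have := (hLT h1).2.2
      have := (hUT h2).2.1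
      linarith
  calc (μ.prod ν).real ((hCross ε₀ 0 0 (27 * s)).event η φ)ᶜ
      ≤ ∑ p : Fin 79 × Bool, ∑ q : Fin 79 × Bool,
          (μ.prod ν).real (((L p).event η φ)ᶜ ∩ ((U q).event η φ)ᶜ) := by
        refine (measureReal_mono hsub (measure_ne_top _ _)).trans
          ((measureReal_iUnion_fintype_le _).trans ?_)
        exact Finset.sum_le_sum fun p _ => measureReal_iUnion_fintype_le _
    _ ≤ ∑ p : Fin 79 × Bool, ∑ q : Fin 79 × Bool,
          ((μ.prod ν).real ((hCross ε₀ 0 0 s).event η φ)ᶜ ^ 2 + piBar ν φ ε₀ (50 * n)) :=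
        Finset.sum_le_sum fun p _ => Finset.sum_le_sum fun q _ => hpair p q
    _ = _ := by
        simp only [Finset.sum_const, Finset.card_univ, Fintype.card_prod, Fintype.card_fin,
          Fintype.card_bool, nsmul_eq_mul]
        push_cast
        ring

end Bootstrap

/-! ### Summability of the probabilities of non-crossing -/

/-- A nonnegative sequence that, up to summable errors, is halved by every third step is
summable. -/
lemma summable_of_le_half_add {u v : ℕ → ℝ} (hu : ∀ k, 0 ≤ u k) (hv0 : ∀ k, 0 ≤ v k)
    (hv : Summable v) (h : ∀ k, u (k + 3) ≤ u k / 2 + v k) : Summable u := by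
  refine summable_of_sum_range_le (c := 2 * (u 0 + u 1 + u 2 + ∑' k, v k)) hu fun n => ?_
  have h1 : ∑ k ∈ Finset.range n, u k ≤ ∑ k ∈ Finset.range (n + 3), u k :=
    Finset.sum_le_sum_of_subset_of_nonneg (Finset.range_mono (by omega)) fun i _ _ => hu i
  have h2 : ∑ k ∈ Finset.range (n + 3), u k =
      ∑ k ∈ Finset.range n, u (k + 3) + (u 0 + u 1 + u 2) := by
    rw [Finset.sum_range_succ', Finset.sum_range_succ', Finset.sum_range_succ']
    ring
  have h3 : ∑ k ∈ Finset.range n, u (k + 3) ≤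
      (∑ k ∈ Finset.range n, u k) / 2 + ∑ k ∈ Finset.range n, v k := by
    rw [Finset.sum_div, ← Finset.sum_add_distrib]
    exact Finset.sum_le_sum fun k _ => h k
  have h4 : ∑ k ∈ Finset.range n, v k ≤ ∑' k, v k := hv.sum_le_tsum _ fun i _ => hv0 i
  linarith

section Percolation

variable {Ω Ω' : Type*} [MeasurableSpace Ω] [MeasurableSpace Ω'] {μ : Measure Ω}
  [IsProbabilityMeasure μ] {ν : Measure Ω'} [IsProbabilityMeasure ν] {lam : ℝ≥0}
  {η : Ω → Set (Plane × unitInterval)} {φ : Ω' → Plane → ℝ≥0}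

/-- A crossing of `[0, 3n] × [0, n]` uses only discs with centres near the rectangle, unless a
distant disc reaches the square of radius `4n`. -/
lemma tendsto_measureReal_hCross_compl (hη : IsPoissonProcess μ lam η)
    (hφ : Measurable (Function.uncurry φ)) {ε₀ : ℝ}
    (hpi : Tendsto (fun n : ℕ => piLam μ ν η φ ε₀ n) atTop (𝓝 0))
    (hcross : Tendsto (fun n : ℕ => (μ.prod ν)
      {w | HasCrossing (occupied (η w.1) (φ w.2)) (3 * n) n}) atTop (𝓝 1)) :
    Tendsto (fun n : ℕ => (μ.prod ν).real ((hCross ε₀ 0 0 n).event η φ)ᶜ) atTop (𝓝 0) := by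
  have hle : ∀ n : ℕ, (μ.prod ν) {w | HasCrossing (occupied (η w.1) (φ w.2)) (3 * n) n} ≤
      (μ.prod ν) ((hCross ε₀ 0 0 n).event η φ) + piLam μ ν η φ ε₀ (4 * n) := by
    intro n
    refine (measure_mono fun w hw => ?_).trans (measure_union_le _ _)
    by_cases hb : occupied (η w.1) (φ w.2) ∩ square 0 ((4 * n : ℕ) : ℝ) =
        occupiedFrom (square 0 ((1 + ε₀ / 4) * ((4 * n : ℕ) : ℝ))) (η w.1) (φ w.2) ∩
          square 0 ((4 * n : ℕ) : ℝ)
    · left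
      obtain ⟨x, y, hx, hy, hxy⟩ := hw
      refine ⟨x, hx, y, by simpa [hCross, axisLine] using hy, hxy.mono ?_⟩
      rintro u ⟨huO, hu⟩
      have hn : (0 : ℝ) ≤ n := Nat.cast_nonneg n
      have hsq : u ∈ square 0 ((4 * n : ℕ) : ℝ) := by
        obtain ⟨_, _, _, _⟩ := hu
        simp only [mem_square, PiLp.zero_apply, sub_zero, abs_le]
        push_cast
        refine ⟨⟨?_, ?_⟩, ?_, ?_⟩ <;> linarith
      have huT : u ∈ occupied (η w.1) (φ w.2) ∩ square 0 ((4 * n : ℕ) : ℝ) := ⟨huO, hsq⟩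
      rw [hb] at huT
      refine ⟨?_, ?_⟩
      · have e : (!₂[0, 0] : Plane) = 0 := by
          ext i
          fin_cases i <;> rfl
        simp only [hCross, e]
        exact_mod_cast huT.1
      · obtain ⟨_, _, _, _⟩ := hu
        refine ⟨⟨?_, ?_⟩, ?_, ?_⟩ <;> linarith
    · right
      exact hb
  have hpi4 : Tendsto (fun n : ℕ => piLam μ ν η φ ε₀ (4 * n)) atTop (𝓝 0) :=
    hpi.comp (tendsto_id.const_mul_atTop' (by norm_num : 0 < 4))
  have h1 : Tendsto (fun n : ℕ => (μ.prod ν) ((hCross ε₀ 0 0 n).event η φ)) atTop (𝓝 1) := by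
    have hsub := ENNReal.Tendsto.sub hcross hpi4 (Or.inl ENNReal.one_ne_top)
    rw [tsub_zero] at hsub
    exact tendsto_of_tendsto_of_tendsto_of_le_of_le hsub tendsto_const_nhds
      (fun n => tsub_le_iff_right.2 (hle n)) fun n => prob_le_one
  have h2 := (ENNReal.tendsto_toReal ENNReal.one_ne_top).comp h1
  have h3 := h2.const_sub 1
  rw [ENNReal.toReal_one, sub_self] at h3
  refine h3.congr fun n => ?_
  rw [probReal_compl_eq_one_sub (LinkData.measurableSet_event _ hη hφ)]
  rfl

/-- The probabilities of non-crossing are summable along the powers of `3`. -/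
lemma summable_measureReal_hCross_compl (hη : IsPoissonProcess μ lam η)
    (hφ : Measurable (Function.uncurry φ)) (hstat : IsStationary ν φ)
    (hrot : IsRotationInvariant ν φ) {ε₀ : ℝ} (hε₀ : 0 < ε₀) (hε₀' : ε₀ ≤ 1 / 5)
    (hpi : Tendsto (fun n : ℕ => piLam μ ν η φ ε₀ n) atTop (𝓝 0))
    (hpibar : ∃ α : ℝ, 0 < α ∧
      ∀ n : ℕ, 2 ≤ n → piBar ν φ ε₀ n ≤ (α * Real.log n) ^ (-(1 + α)))
    (hcross : Tendsto (fun n : ℕ => (μ.prod ν)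
      {w | HasCrossing (occupied (η w.1) (φ w.2)) (3 * n) n}) atTop (𝓝 1)) :
    Summable fun k : ℕ => (μ.prod ν).real ((hCross ε₀ 0 0 (3 ^ k)).event η φ)ᶜ := by
  obtain ⟨α, hα, hpibar⟩ := hpibar
  set u : ℕ → ℝ := fun k => (μ.prod ν).real ((hCross ε₀ 0 0 (3 ^ k)).event η φ)ᶜ with hu
  have hlim : Tendsto u atTop (𝓝 0) := by
    have h := (tendsto_measureReal_hCross_compl hη hφ hpi hcross).comp
      (tendsto_pow_atTop_atTop_of_one_lt (by norm_num : (1 : ℕ) < 3))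
    refine h.congr fun k => ?_
    simp [hu]
  have hu0 : ∀ k, 0 ≤ u k := fun k => measureReal_nonneg
  obtain ⟨k₀, hk₀⟩ := eventually_atTop.1
    (hlim.eventually (gt_mem_nhds (show (0 : ℝ) < 1 / (2 * 158 ^ 2) by norm_num)))
  set v : ℕ → ℝ := fun k => 158 ^ 2 * (α ^ (-(1 + α)) * ((k + (k₀ + 1) : ℕ) : ℝ) ^ (-(1 + α)))
    with hv
  have hsum : Summable v := by
    refine Summable.mul_left _ (Summable.mul_left _ ?_)
    exact (summable_nat_add_iff (k₀ + 1)).2 (Real.summable_nat_rpow.2 (by linarith))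
  refine (summable_nat_add_iff (k₀ + 1)).1
    (summable_of_le_half_add (fun k => hu0 _) (fun k => by positivity) hsum fun k => ?_)
  set m := k + (k₀ + 1) with hm
  have hboot := measureReal_hCross_compl_le hη hφ hstat hrot hε₀ hε₀' (n := 3 ^ m) (by positivity)
  have e : (27 : ℝ) * ((3 ^ m : ℕ) : ℝ) = 3 ^ (m + 3) := by push_cast; ring
  have e' : ((3 ^ m : ℕ) : ℝ) = 3 ^ m := by push_cast; ring
  rw [e, e'] at hboot
  have hb := hpibar (50 * 3 ^ m) (by have := Nat.one_le_pow m 3 (by norm_num); omega)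
  have hmpos : (0 : ℝ) < m := by rw [hm]; positivity
  -- Since `exp 1 ≤ 3`, the logarithm of the scale grows at least linearly in `m`.
  have hlog : (m : ℝ) ≤ Real.log ((50 * 3 ^ m : ℕ) : ℝ) := by
    rw [Real.le_log_iff_exp_le (by positivity), ← mul_one (m : ℝ), Real.exp_nat_mul]
    push_cast
    have h3 : Real.exp 1 ≤ 3 := Real.exp_one_lt_three.le
    have h4 : Real.exp 1 ^ m ≤ 3 ^ m := pow_le_pow_left₀ (Real.exp_pos 1).le h3 m
    have h5 : (0 : ℝ) < 3 ^ m := by positivity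
    linarith
  have hb' : piBar ν φ ε₀ (50 * 3 ^ m) ≤ α ^ (-(1 + α)) * (m : ℝ) ^ (-(1 + α)) := by
    refine hb.trans ?_
    rw [← Real.mul_rpow hα.le hmpos.le]
    exact Real.rpow_le_rpow_of_nonpos (by positivity) (mul_le_mul_of_nonneg_left hlog hα.le)
      (by linarith)
  have hsmall : u m < 1 / (2 * 158 ^ 2) := hk₀ m (by omega)
  have hsq : 158 ^ 2 * u m ^ 2 ≤ u m / 2 := by nlinarith [hu0 m]
  have e2 : k + 3 + (k₀ + 1) = m + 3 := by omega
  change u (k + 3 + (k₀ + 1)) ≤ u m / 2 + v k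
  rw [e2]
  calc u (m + 3) ≤ 158 ^ 2 * (u m ^ 2 + piBar ν φ ε₀ (50 * 3 ^ m)) := hboot
    _ ≤ u m / 2 + v k := by
      rw [mul_add]
      exact add_le_add hsq (mul_le_mul_of_nonneg_left hb' (by norm_num))

/-- With positive probability, all the rectangles from some scale on are crossed. -/
lemma exists_measure_iInter_cross_pos (hη : IsPoissonProcess μ lam η)
    (hφ : Measurable (Function.uncurry φ)) (hstat : IsStationary ν φ)
    (hrot : IsRotationInvariant ν φ) {ε₀ : ℝ}
    (hsum : Summable fun k : ℕ => (μ.prod ν).real ((hCross ε₀ 0 0 (3 ^ k)).event η φ)ᶜ) :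
    ∃ K : ℕ, 0 < (μ.prod ν) (⋂ k : ℕ, (hCross ε₀ 0 0 (3 ^ (k + K))).event η φ ∩
      (vCross ε₀ 0 0 (3 ^ (k + K))).event η φ) := by
  set u : ℕ → ℝ := fun k => (μ.prod ν).real ((hCross ε₀ 0 0 (3 ^ k)).event η φ)ᶜ with hu
  obtain ⟨K, hK⟩ := ((tendsto_sum_nat_add u).eventually
    (gt_mem_nhds (show (0 : ℝ) < 1 / 2 by norm_num))).exists
  refine ⟨K, ?_⟩
  set G := ⋂ k : ℕ, (hCross ε₀ 0 0 (3 ^ (k + K))).event η φ ∩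
      (vCross ε₀ 0 0 (3 ^ (k + K))).event η φ with hG
  by_contra! h
  have hGm : MeasurableSet G := MeasurableSet.iInter fun k =>
    (LinkData.measurableSet_event _ hη hφ).inter (LinkData.measurableSet_event _ hη hφ)
  have hGc : (μ.prod ν) Gᶜ = 1 := by
    rw [prob_compl_eq_one_sub hGm, le_antisymm h zero_le, tsub_zero]
  have hle : (μ.prod ν) Gᶜ ≤ ∑' k, ENNReal.ofReal (2 * u (k + K)) := by
    rw [hG, Set.compl_iInter]
    refine (measure_iUnion_le _).trans (ENNReal.tsum_le_tsum fun k => ?_)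
    rw [Set.compl_inter, two_mul, ENNReal.ofReal_add measureReal_nonneg measureReal_nonneg]
    refine (measure_union_le _ _).trans (add_le_add ?_ ?_)
    · rw [ofReal_measureReal]
    · rw [← measureReal_vCross_compl hη hφ hstat hrot ε₀ 0 0, ofReal_measureReal]
  have hsum' : Summable fun k => 2 * u (k + K) :=
    ((summable_nat_add_iff K).2 hsum).mul_left 2
  rw [hGc, ← ENNReal.ofReal_tsum_of_nonneg (fun k => by positivity) hsum', tsum_mul_left] at hle
  have : ENNReal.ofReal (2 * ∑' k, u (k + K)) < 1 := by
    rw [ENNReal.ofReal_lt_one]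
    linarith
  exact absurd hle (not_le.2 this)

end Percolation

/-! ### Unbounded components -/

section Components

variable {Ω Ω' : Type*} {η : Ω → Set (Plane × unitInterval)} {φ : Ω' → Plane → ℝ≥0}

/-- The points `x` and `y` are connected by a curve that is covered by the discs with centres in some
bounded set. -/
def LocallyJoined (s : Set (Plane × unitInterval)) (f : Plane → ℝ≥0) (x y : Plane) : Prop :=
  ∃ T : Set Plane, Bornology.IsBounded T ∧ JoinedIn (occupiedFrom T s f) x y

lemma LocallyJoined.symm {s : Set (Plane × unitInterval)} {f : Plane → ℝ≥0} {x y : Plane}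
    (h : LocallyJoined s f x y) : LocallyJoined s f y x := by
  obtain ⟨T, hT, h⟩ := h
  exact ⟨T, hT, h.symm⟩

lemma LocallyJoined.trans {s : Set (Plane × unitInterval)} {f : Plane → ℝ≥0} {x y z : Plane}
    (h : LocallyJoined s f x y) (h' : LocallyJoined s f y z) : LocallyJoined s f x z := by
  obtain ⟨T, hT, h⟩ := h
  obtain ⟨T', hT', h'⟩ := h'
  exact ⟨T ∪ T', hT.union hT', (h.mono (occupiedFrom_mono Set.subset_union_left s f)).trans
    (h'.mono (occupiedFrom_mono Set.subset_union_right s f))⟩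

/-- The point `q` is connected to distance `R` inside the square of radius `k` around `q`, by
discs with centres in this square. -/
def reach (q : Plane) (R k : ℕ) : LinkData where
  W := square q k
  A := {q}
  B := {u | (R : ℝ) ≤ ‖u - q‖}
  T := square q k
  compact_W := isCompact_square _ _
  convex_W := convex_square _ _
  closed_A := isClosed_singleton
  closed_B := isClosed_le continuous_const (by fun_prop)
  bounded_T := (isCompact_square _ _).isBounded
  measurable_T := (isCompact_square _ _).measurableSet

lemma reach_comap (q : Plane) (R k : ℕ) :
    (reach q R k).comap (AffineIsometryEquiv.constVAdd ℝ Plane q) = reach 0 R k := by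
  refine LinkData.ext ?_ ?_ ?_ ?_ <;> ext u <;>
  simp [LinkData.comap, reach, mem_square]

lemma square_mono (q : Plane) {r r' : ℝ} (h : r ≤ r') : square q r ⊆ square q r' :=
  fun _ hu i => (hu i).trans h

/-- The point `q` is connected to arbitrarily distant points by finite chains of discs. Unlike the
event that `q` lies on an unbounded curve, this event is visibly measurable. -/
def unboundedEvent (η : Ω → Set (Plane × unitInterval)) (φ : Ω' → Plane → ℝ≥0) (q : Plane) :
    Set (Ω × Ω') :=
  ⋂ R : ℕ, ⋃ k : ℕ, (reach q R k).event η φ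

lemma mem_unboundedEvent_of_locallyJoined {w : Ω × Ω'} {q : Plane}
    (h : ∀ R : ℕ, ∃ y, (R : ℝ) ≤ ‖y - q‖ ∧ LocallyJoined (η w.1) (φ w.2) q y) :
    w ∈ unboundedEvent η φ q := by
  refine Set.mem_iInter.2 fun R => Set.mem_iUnion.2 ?_
  obtain ⟨y, hy, T, hT, γ, hγ⟩ := h R
  have hbd : Bornology.IsBounded (Set.range γ ∪ T) :=
    (isCompact_range γ.continuous).isBounded.union hT
  obtain ⟨r, hr⟩ := hbd.subset_closedBall q
  obtain ⟨k, hk⟩ := exists_nat_ge r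
  have hsq : Set.range γ ∪ T ⊆ square q k := by
    intro u hu i
    have h1 : ‖u - q‖ ≤ r := by simpa [dist_eq_norm] using hr hu
    have h2 := PiLp.norm_apply_le (u - q) i
    simp only [PiLp.sub_apply, Real.norm_eq_abs] at h2
    linarith
  exact ⟨k, q, rfl, y, hy, γ, fun t =>
    ⟨occupiedFrom_mono (Set.subset_union_right.trans hsq) _ _ (hγ t), hsq (Or.inl ⟨t, rfl⟩)⟩⟩

/-- A curve between two different vertical lines in a finite union of discs meets a disc of positive
radius, so that it is connected to a point of any given dense sequence. -/
lemma exists_denseRange_locallyJoined {s : Set (Plane × unitInterval)} {f : Plane → ℝ≥0}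
    {T : Set Plane} (hT : Bornology.IsBounded T) (hs : (s ∩ slab T).Finite) {x y : Plane}
    (hxy : x 0 < y 0) (h : JoinedIn (occupiedFrom T s f) x y) {q : ℕ → Plane}
    (hq : DenseRange q) : ∃ m, LocallyJoined s f (q m) x := by
  obtain ⟨γ, hγ⟩ := h
  obtain ⟨t, p, hp, hpt, hpos⟩ : ∃ t, ∃ p ∈ s ∩ slab T,
      γ t ∈ Metric.closedBall p.1 (f p.1) ∧ 0 < f p.1 := by
    -- Otherwise the curve would consist of the finitely many centres.
    by_contra! hzero
    have hsub : Set.range γ ⊆ Prod.fst '' (s ∩ slab T) := by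
      rintro _ ⟨t, rfl⟩
      obtain ⟨p, hp, hpt⟩ := Set.mem_iUnion₂.1 (hγ t)
      have h0 := hzero t p hp hpt
      rw [nonpos_iff_eq_zero.1 h0, NNReal.coe_zero, Metric.closedBall_zero] at hpt
      exact ⟨p, hp, hpt.symm⟩
    have hfin : ((fun u : Plane => u 0) '' Set.range γ).Finite :=
      ((hs.image _).subset hsub).image _
    have hconn : ((fun u : Plane => u 0) '' Set.range γ).OrdConnected :=
      ((isPreconnected_range γ.continuous).image _ (by fun_prop)).ordConnected
    refine (Set.Icc_infinite hxy) (hfin.subset (hconn.out ?_ ?_))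
    · exact ⟨x, ⟨0, γ.source⟩, rfl⟩
    · exact ⟨y, ⟨1, γ.target⟩, rfl⟩
  obtain ⟨m, hm⟩ := hq.exists_mem_open Metric.isOpen_ball
    ⟨p.1, Metric.mem_ball_self (NNReal.coe_pos.2 hpos)⟩
  refine ⟨m, T, hT, ?_⟩
  have hball : Metric.closedBall p.1 (f p.1) ⊆ occupiedFrom T s f :=
    Set.subset_biUnion_of_mem (u := fun p : Plane × unitInterval => Metric.closedBall p.1 (f p.1)) hp
  have h1 : JoinedIn (occupiedFrom T s f) (q m) (γ t) :=
    (((convex_closedBall p.1 (f p.1 : ℝ)).isPathConnected ⟨_, hpt⟩).joinedIn _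
      (Metric.ball_subset_closedBall hm) _ hpt).mono hball
  have h2 : JoinedIn (occupiedFrom T s f) x (γ t) := by
    have h := (((convex_Icc (0 : ℝ) 1).isPathConnected ⟨0, by simp⟩).image
      γ.continuous_extend).joinedIn _ ⟨0, by simp, γ.extend_zero⟩ _ ⟨t, t.2, γ.extend_apply t.2⟩
    refine h.mono ?_
    rintro _ ⟨r, hr, rfl⟩
    exact γ.extend_apply hr ▸ hγ ⟨r, hr⟩
  exact h1.trans h2.symm

/-- If all the rectangles from some scale on are crossed, then their crossings form an unbounded
component. -/
lemma exists_mem_unboundedEvent {ε₀ : ℝ} {K : ℕ} {w : Ω × Ω'}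
    (hfin : ∀ T : Set Plane, Bornology.IsBounded T → (η w.1 ∩ slab T).Finite)
    (hw : ∀ k : ℕ, w ∈ (hCross ε₀ 0 0 (3 ^ (k + K))).event η φ ∧
      w ∈ (vCross ε₀ 0 0 (3 ^ (k + K))).event η φ) {q : ℕ → Plane} (hq : DenseRange q) :
    ∃ m, w ∈ unboundedEvent η φ (q m) := by
  choose a ha b hb hab using fun k => (hw k).1
  choose c hc d hd hcd using fun k => (hw k).2
  have ha0 : ∀ k, a k 0 = 0 := ha
  have hb0 : ∀ k, b k 0 = 0 + 3 * 3 ^ (k + K) := hb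
  have hc0 : ∀ k, c k 1 = 0 := hc
  have hd0 : ∀ k, d k 1 = 0 + 3 * 3 ^ (k + K) := hd
  have cross : ∀ k l, k ≤ l → l ≤ k + 1 → LocallyJoined (η w.1) (φ w.2) (a l) (c k) := by
    intro k l hkl hlk
    have hp : (0 : ℝ) < 3 ^ (k + K) := by positivity
    have h1 : (3 : ℝ) ^ (k + K) ≤ 3 ^ (l + K) := pow_le_pow_right₀ (by norm_num) (by omega)
    have h2 : (3 : ℝ) ^ (l + K) ≤ 3 * 3 ^ (k + K) := by
      rw [← pow_succ']
      exact pow_le_pow_right₀ (by norm_num) (by omega)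
    refine ⟨(hCross ε₀ 0 0 (3 ^ (l + K))).T ∪ (vCross ε₀ 0 0 (3 ^ (k + K))).T,
      (LinkData.bounded_T _).union (LinkData.bounded_T _), ?_⟩
    refine joinedIn_of_cross (hab l) (hcd k)
      (Set.inter_subset_left.trans (occupiedFrom_mono Set.subset_union_left _ _))
      (Set.inter_subset_left.trans (occupiedFrom_mono Set.subset_union_right _ _))
      (a := 0) (b := 3 ^ (k + K)) (c := 0) (d := 3 ^ (l + K))
      (ha0 l).le (by rw [hb0]; linarith) (fun u hu => ?_) (hc0 k).le (by rw [hd0]; linarith)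
      (fun u hu => ?_)
    · have := hu.2.2
      exact ⟨this.1, this.2.trans_eq (zero_add _)⟩
    · have := hu.2.1
      exact ⟨this.1, this.2.trans_eq (zero_add _)⟩
  have hjoin : ∀ k, LocallyJoined (η w.1) (φ w.2) (a k) (b k) := fun k =>
    ⟨_, LinkData.bounded_T _, (hab k).mono Set.inter_subset_left⟩
  have hstep : ∀ k, LocallyJoined (η w.1) (φ w.2) (a 0) (a k) := by
    intro k
    induction k with
    | zero => exact (hjoin 0).trans (hjoin 0).symm
    | succ k ih =>
      exact ih.trans ((cross k k le_rfl (by omega)).trans (cross k (k + 1) (by omega) le_rfl).symm)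
  obtain ⟨m, hm⟩ := exists_denseRange_locallyJoined
    (hCross ε₀ 0 0 (3 ^ (0 + K))).bounded_T
    (hfin _ (hCross ε₀ 0 0 (3 ^ (0 + K))).bounded_T)
    (by rw [ha0, hb0]; positivity) ((hab 0).mono Set.inter_subset_left) hq
  refine ⟨m, mem_unboundedEvent_of_locallyJoined fun R => ?_⟩
  obtain ⟨k, hk⟩ := pow_unbounded_of_one_lt (R + |q m 0|) (by norm_num : (1 : ℝ) < 3)
  refine ⟨b k, ?_, hm.trans ((hstep k).trans (hjoin k))⟩
  have h1 : (3 : ℝ) ^ k ≤ 3 ^ (k + K) := pow_le_pow_right₀ (by norm_num) (by omega)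
  have h2 := PiLp.norm_apply_le (b k - q m) 0
  rw [PiLp.sub_apply, hb0, Real.norm_eq_abs] at h2
  have h3 := le_abs_self (0 + 3 * 3 ^ (k + K) - q m 0)
  have h4 := le_abs_self (q m 0)
  have h5 : (0 : ℝ) < 3 ^ k := by positivity
  linarith

end Components

section Invariance

variable {Ω Ω' : Type*} [MeasurableSpace Ω] [MeasurableSpace Ω'] {μ : Measure Ω}
  [IsProbabilityMeasure μ] {ν : Measure Ω'} [IsProbabilityMeasure ν] {lam : ℝ≥0}
  {η : Ω → Set (Plane × unitInterval)} {φ : Ω' → Plane → ℝ≥0}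

lemma measure_unboundedEvent (hη : IsPoissonProcess μ lam η)
    (hφ : Measurable (Function.uncurry φ)) (q : Plane) :
    (μ.prod ν) (unboundedEvent η φ q) = ⨅ R : ℕ, ⨆ k : ℕ, (μ.prod ν) ((reach q R k).event η φ) := by
  have hmono : ∀ R, Monotone fun k => (reach q R k).event η φ := by
    intro R k l hkl w hw
    have hsq : square q k ⊆ square q l := square_mono q (by exact_mod_cast hkl)
    exact Linked.mono hsq le_rfl le_rfl (occupiedFrom_mono hsq _ _) hw
  have hanti : Antitone fun R => ⋃ k, (reach q R k).event η φ := by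
    intro R R' hR
    refine Set.iUnion_mono fun k w hw => ?_
    refine Linked.mono (B := {u | (R' : ℝ) ≤ ‖u - q‖}) le_rfl le_rfl (fun u hu => ?_) le_rfl hw
    exact (show (R : ℝ) ≤ R' by exact_mod_cast hR).trans hu
  rw [unboundedEvent, hanti.measure_iInter (fun R => (MeasurableSet.iUnion fun k =>
    LinkData.measurableSet_event _ hη hφ).nullMeasurableSet) ⟨0, measure_ne_top _ _⟩]
  exact iInf_congr fun R => (hmono R).measure_iUnion

lemma measure_unboundedEvent_eq (hη : IsPoissonProcess μ lam η)
    (hφ : Measurable (Function.uncurry φ)) (hstat : IsStationary ν φ) (q : Plane) :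
    (μ.prod ν) (unboundedEvent η φ q) = (μ.prod ν) (unboundedEvent η φ 0) := by
  rw [measure_unboundedEvent hη hφ, measure_unboundedEvent hη hφ]
  refine iInf_congr fun R => iSup_congr fun k => ?_
  rw [LinkData.measure_event_comap _ hη hφ (isSymmetry_constVAdd hstat q), reach_comap]

end Invariance

/-- Countably many curves in `O` that start at the same point can be concatenated. -/
lemma exists_continuous_of_joinedIn {O : Set Plane} {x : Plane} {y : ℕ → Plane}
    (h : ∀ n, JoinedIn O x (y n)) :
    ∃ γ : ℝ≥0 → Plane, Continuous γ ∧ γ 0 = x ∧ (∀ t, γ t ∈ O) ∧ ∀ n, ∃ t, γ t = y n := by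
  let z : ℕ → Plane := fun n => n.casesOn x y
  have hz : ∀ n, JoinedIn O x (z n) := by
    rintro (_ | n)
    · exact JoinedIn.refl (h 0).source_mem
    · exact h n
  choose P hP using fun n => (hz n).symm.trans (hz (n + 1))
  let γ : ℝ≥0 → Plane := fun t => (P ⌊t⌋₊).extend ((t : ℝ) - ⌊t⌋₊)
  have heq : ∀ n : ℕ, Set.EqOn γ (fun t => (P n).extend ((t : ℝ) - n)) (Set.Icc (n : ℝ≥0) (n + 1)) := by
    rintro n t ⟨h1, h2⟩
    rcases h2.lt_or_eq with h2 | rfl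
    · have : ⌊t⌋₊ = n := (Nat.floor_eq_iff zero_le).2 ⟨h1, h2⟩
      simp only [γ]
      rw [this]
    · have e : ⌊(n : ℝ≥0) + 1⌋₊ = n + 1 := by exact_mod_cast Nat.floor_natCast (R := ℝ≥0) (n + 1)
      simp only [γ]
      rw [e]
      push_cast
      simp
  have hval : ∀ n : ℕ, γ n = z n := by
    intro n
    rw [heq n ⟨le_rfl, by simp⟩]
    simp
  refine ⟨γ, ?_, ?_, fun t => ?_, fun n => ⟨((n + 1 : ℕ) : ℝ≥0), hval (n + 1)⟩⟩
  · have hlf : LocallyFinite fun n : ℕ => Set.Icc (n : ℝ≥0) (n + 1) := by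
      intro t
      obtain ⟨N, hN⟩ := exists_nat_ge (t + 1)
      refine ⟨Set.Iio (t + 1), Iio_mem_nhds (by simp), (Set.finite_Iio N).subset ?_⟩
      rintro n ⟨u, hu, hut⟩
      have : (n : ℝ≥0) < N := (hu.1.trans_lt hut).trans_le hN
      exact_mod_cast this
    refine hlf.continuous ?_ (fun n => isClosed_Icc) fun n => ?_
    · refine Set.eq_univ_of_forall fun t => Set.mem_iUnion.2 ⟨⌊t⌋₊, Nat.floor_le zero_le, ?_⟩
      exact (Nat.lt_floor_add_one t).le
    · refine ContinuousOn.congr (Continuous.continuousOn ?_) (heq n)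
      exact (P n).continuous_extend.comp (by fun_prop)
  · simpa [z] using hval 0
  · exact hP _ _

lemma originToInfinity_of_joinedIn {O : Set Plane}
    (h : ∀ R : ℕ, ∃ y, (R : ℝ) ≤ ‖y‖ ∧ JoinedIn O 0 y) : OriginToInfinity O := by
  choose y hy hj using h
  obtain ⟨γ, hγ, h0, hO, hex⟩ := exists_continuous_of_joinedIn hj
  refine ⟨γ, hγ, h0, hO, fun R => ?_⟩
  obtain ⟨n, hn⟩ := exists_nat_gt R
  obtain ⟨t, ht⟩ := hex n
  exact ⟨t, ht ▸ hn.trans_le (hy n)⟩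

end Gilbert

theorem proposition4p2
    {Ω Ω' : Type*} [MeasurableSpace Ω] [MeasurableSpace Ω']
    (μ : Measure Ω) [IsProbabilityMeasure μ] (ν : Measure Ω') [IsProbabilityMeasure ν]
    (lam : ℝ≥0) (η : Ω → Set (Gilbert.Plane × unitInterval))
    (hη : Gilbert.IsPoissonProcess μ lam η)
    (φ : Ω' → Gilbert.Plane → ℝ≥0) (hφ : Measurable (Function.uncurry φ))
    (hstat : Gilbert.IsStationary ν φ) (herg : Gilbert.IsErgodicField ν φ)
    (hrot : Gilbert.IsRotationInvariant ν φ)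
    (ε₀ : ℝ) (hε₀ : 0 < ε₀) (hε₀' : ε₀ ≤ 1 / 5)
    (hpi : Tendsto (fun n : ℕ => Gilbert.piLam μ ν η φ ε₀ n) atTop (𝓝 0))
    (hpibar : ∃ α : ℝ, 0 < α ∧
      ∀ n : ℕ, 2 ≤ n → Gilbert.piBar ν φ ε₀ n ≤ (α * Real.log n) ^ (-(1 + α)))
    (hcross : Tendsto (fun n : ℕ => (μ.prod ν)
      {w | Gilbert.HasCrossing (Gilbert.occupied (η w.1) (φ w.2)) (3 * n) n}) atTop (𝓝 1)) :
    0 < (μ.prod ν) {w | Gilbert.OriginToInfinity (Gilbert.occupied (η w.1) (φ w.2))} := by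
  obtain ⟨K, hK⟩ := Gilbert.exists_measure_iInter_cross_pos hη hφ hstat hrot
    (Gilbert.summable_measureReal_hCross_compl hη hφ hstat hrot hε₀ hε₀' hpi hpibar hcross)
  have hcov : (⋂ k : ℕ, (Gilbert.hCross ε₀ 0 0 (3 ^ (k + K))).event η φ ∩
      (Gilbert.vCross ε₀ 0 0 (3 ^ (k + K))).event η φ) ⊆
      ⋃ m, Gilbert.unboundedEvent η φ (TopologicalSpace.denseSeq Gilbert.Plane m) := by
    intro w hw
    exact Set.mem_iUnion.2 (Gilbert.exists_mem_unboundedEvent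
      (fun T hT => hη.finite_slab hT w.1) (Set.mem_iInter.1 hw)
      (TopologicalSpace.denseRange_denseSeq Gilbert.Plane))
  have hpos : (μ.prod ν) (Gilbert.unboundedEvent η φ 0) ≠ 0 := by
    intro h0
    refine hK.ne' (measure_mono_null hcov (measure_iUnion_null fun m => ?_))
    rw [Gilbert.measure_unboundedEvent_eq hη hφ hstat, h0]
  refine (pos_iff_ne_zero.2 hpos).trans_le (measure_mono fun w hw => ?_)
  refine Gilbert.originToInfinity_of_joinedIn fun R => ?_
  obtain ⟨k, x, hx, y, hy, hxy⟩ := Set.mem_iUnion.1 (Set.mem_iInter.1 hw R)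
  obtain rfl : x = 0 := hx
  exact ⟨y, by simpa [Gilbert.reach] using hy, hxy.mono
    (Set.inter_subset_left.trans (Gilbert.occupiedFrom_subset _ _ _))⟩
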